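/- Let $1\le p<n$ and $1\le k<n/2$ be integers. Let $\boldsymbol Z=\boldsymbol Z_{n,p}$ be the $n\times p$ matrix whose first $p-1$ columns have independent standard Gaussian entries and whose last column (the intercept) consists of ones; let $\boldsymbol z_i^{T}$ be its $i$-th row and $P_{\boldsymbol Z^\perp}=I-\boldsymbol Z(\boldsymbol Z^{T}\boldsymbol Z)^{-1}\boldsymbol Z^{T}$. An assignment is a vector $\boldsymbol x\in\{0,1\}^n$ with $\sum_i x_i=k$. Consider the linear model $y_i=\beta x_i+\boldsymbol\gamma^{T}\boldsymbol z_i+\epsilon_i$, where $\epsilon$ is white noise of variance $1$ (square integrable, centered, uncorrelated), and let $\hat\beta$ be the ordinary least squares estimate of $\beta$. Put $$V(n,p,k)=\mathbb E_{\boldsymbol Z}\Big[\max_{\boldsymbol x\in\{0,1\}^n,\ \sum_i x_i=k}\boldsymbol x^{T}P_{\boldsymbol Z^\perp}\boldsymbol x\Big].$$ (i) For almost every $\boldsymbol Z$, every assignment $\boldsymbol x$ satisfies $\boldsymbol x^{T}P_{\boldsymbol Z^\perp}\boldsymbol x>0$, and for fixed $\boldsymbol Z,\boldsymbol x$ one has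 $\operatorname{Var}\hat\beta=1/(\boldsymbol x^{T}P_{\boldsymbol Z^\perp}\boldsymbol x)$ for all $\beta,\boldsymbol\gamma$. So $V(n,p,k)$ is the mean inverse variance achieved by the optimal assignment. (ii) The rate guaranteed in every dimension $p<n$ is $\Theta\big(k^2\log(n/k)/n\big)$: there are absolute constants $c,C>0$ such that, for all $n,k$ with $1\le k<n/2$, $$V(n,p,k)\ \ge\ c\,\frac{k^2\log(n/k)}{n}\quad\text{for every }1\le p<n,\qquad V(n,n-1,k)\ \le\ C\,\frac{k^2\log(n/k)}{n}.$$ (iii) When a constant fraction of the users is treated, the rate is linear in every dimension: for every $\rho\in(0,1/2)$ there are $c_\rho,C_\rho>0$ such that, for all $n,k$ with $\rho\le k/n<1/2$ (in particular for $k/n=\rho$) and all $1\le p<n$, $$c_\rho\, n\le V(n,p,k)\le C_\rho\, n\qquad\text{and}\qquad c_\rho\,\frac{k^2\log(n/k)}{n}\le V(n,p,k)\le C_\rho\,\frac{k^2\log(n/k)}{n}.$$ -/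

import Mathlib

open MeasureTheory ProbabilityTheory Matrix

namespace TreatmentAssignment

/-- The law of `n` users' random covariates: an `n × d` array of independent standard Gaussians
(row `i` holds the `d` non-constant covariates of user `i`). -/
noncomputable def gaussianCovariates (n d : ℕ) : Measure (Fin n → Fin d → ℝ) :=
  Measure.pi fun _ => Measure.pi fun _ => gaussianReal 0 1

/-- The data matrix `Z`, with `n` rows and `p = d + 1` columns: the `d` covariates of each user,
followed by the intercept column of ones. -/
def dataMatrix {n d : ℕ} (G : Fin n → Fin d → ℝ) : Matrix (Fin n) (Fin (d + 1)) ℝ :=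
  Matrix.of fun i => Fin.snoc (G i) 1

/-- `P_{Z^⊥} = I - Z (Zᵀ Z)⁻¹ Zᵀ`. -/
noncomputable def perpProj {n p : ℕ} (Z : Matrix (Fin n) (Fin p) ℝ) :
    Matrix (Fin n) (Fin n) ℝ :=
  1 - Z * (Zᵀ * Z)⁻¹ * Zᵀ

/-- The objective `xᵀ P_{Z^⊥} x`. -/
noncomputable def precision {n p : ℕ} (Z : Matrix (Fin n) (Fin p) ℝ) (x : Fin n → ℝ) : ℝ :=
  x ⬝ᵥ (perpProj Z *ᵥ x)

/-- The feasible assignments: `x ∈ {0, 1}ⁿ` with `∑ xᵢ = k`. -/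
def assignments (n k : ℕ) : Set (Fin n → ℝ) :=
  {x | (∀ i, x i = 0 ∨ x i = 1) ∧ ∑ i, x i = k}

/-- The optimal value of `xᵀ P_{Z^⊥} x` over the assignments treating exactly `k` users
(a maximum over a finite set, nonempty when `k ≤ n`). -/
noncomputable def optValue {n p : ℕ} (Z : Matrix (Fin n) (Fin p) ℝ) (k : ℕ) : ℝ :=
  sSup (precision Z '' assignments n k)

/-- The expectation, over the covariates, of the optimal value (with `p = d + 1` columns). -/
noncomputable def meanOptValue (n d k : ℕ) : ℝ :=
  ∫ G, optValue (dataMatrix G) k ∂(gaussianCovariates n d)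

/-- White noise of variance one: square integrable, centered, uncorrelated, unit variances. -/
def IsWhiteNoise {Ω : Type*} [MeasurableSpace Ω] {n : ℕ} (ε : Fin n → Ω → ℝ)
    (μ : Measure Ω) : Prop :=
  (∀ i, MemLp (ε i) 2 μ) ∧ (∀ i, ∫ ω, ε i ω ∂μ = 0) ∧
    ∀ i j, covariance (ε i) (ε j) μ = if i = j then 1 else 0

/-- The linear model `yᵢ = β xᵢ + γᵀ zᵢ + eᵢ`, where `zᵢ` is row `i` of `Z`. -/
def response {n p : ℕ} (Z : Matrix (Fin n) (Fin p) ℝ) (x : Fin n → ℝ) (β : ℝ)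
    (γ : Fin p → ℝ) (e : Fin n → ℝ) : Fin n → ℝ :=
  fun i => β * x i + γ ⬝ᵥ Z i + e i

/-- The regression matrix `[x | Z]`. -/
def regMatrix {n p : ℕ} (Z : Matrix (Fin n) (Fin p) ℝ) (x : Fin n → ℝ) :
    Matrix (Fin n) (Fin (p + 1)) ℝ :=
  Matrix.of fun i => Fin.cons (x i) (Z i)

/-- The ordinary least squares estimate of `β` from the data `y`: the coefficient of `x` in
`(Wᵀ W)⁻¹ Wᵀ y`, where `W = [x | Z]`. -/
noncomputable def olsBeta {n p : ℕ} (Z : Matrix (Fin n) (Fin p) ℝ) (x : Fin n → ℝ)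
    (y : Fin n → ℝ) : ℝ :=
  (((regMatrix Z x)ᵀ * regMatrix Z x)⁻¹ *ᵥ ((regMatrix Z x)ᵀ *ᵥ y)) 0

/-- The rate `k² log (n / k) / n`. -/
noncomputable def rate (n k : ℕ) : ℝ :=
  (k : ℝ) ^ 2 * Real.log ((n : ℝ) / k) / n

end TreatmentAssignment

/-!
The least squares estimate of `β` pairs the residual `P x` of the treatment vector with the response
(`olsBeta_eq`), so its variance is `1 / xᵀ P x`. The data matrix has full rank almost surely, and no
nonconstant vector fixed in advance lies in its column space, because independent Gaussian columns
are linearly independent modulo any fixed subspace as long as the dimensions permit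
(`ae_eq_zero_of_sum_mem`).

For the rates, let `g` be a standard Gaussian vector independent of the covariates, and `u` the
direction of its residual `P g`. By Cauchy–Schwarz `(x ⬝ᵥ u) ^ 2 ≤ xᵀ P x`, with equality when `P`
has rank one, that is for `n - 1` columns. The law of `u` is invariant under the orthogonal maps
fixing the ones vector, which forces `u`, scaled by the length of an independent centered Gaussian
vector, to be itself a centered Gaussian vector `center h` (`map_norm_smul_eq_map_center`). Since
the objective is homogeneous of degree two and `𝔼 |center h|² = n - 1`, the quantity
`𝔼 max_x (x ⬝ᵥ center h) ^ 2 / (n - 1)` bounds the mean optimal value below for every number of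
columns, and equals it for `n - 1` columns (`integral_maxSq_center_le`, `integral_maxSq_center_eq`).

What is left is to show that this Gaussian maximum has order `k² log (n / k)`. Above,
`(x ⬝ᵥ h) ^ 2 ≤ k ∑ xᵢ hᵢ²`, and each `hᵢ²` is controlled by `log (n / k)` plus a multiple of
`(k / n) exp (a hᵢ²)`, whose sum over all users is integrable and free of `x`
(`maxSq_center_le`). Below, the users are divided into `k` disjoint groups of size `⌊n / k⌋ ≥ 2` and
the best user of each group is treated; the maximum of `m ≥ 2` independent standard Gaussians has
mean at least a constant times `√(log m)` (`exists_le_integral_sup'`).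

When `k / n` is bounded below, the rate `k² log (n / k) / n` is at least a constant times `n`, and
the trivial bound `xᵀ P x ≤ xᵀ x = k ≤ n` matches it.
-/

namespace TreatmentAssignment

/-! ### The residual projection and the least squares estimate -/

section LinearAlgebra

variable {n p : ℕ}

lemma isUnit_det_of_injective (Z : Matrix (Fin n) (Fin p) ℝ) (h : ∀ v, Z *ᵥ v = 0 → v = 0) :
    IsUnit (Zᵀ * Z).det := by
  rw [← Matrix.isUnit_iff_isUnit_det, ← Matrix.mulVec_injective_iff_isUnit]
  intro a b hab
  have h0 : (Zᵀ * Z) *ᵥ (a - b) = 0 := by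
    rw [Matrix.mulVec_sub]; exact sub_eq_zero.2 hab
  have h1 : (Z *ᵥ (a - b)) ⬝ᵥ (Z *ᵥ (a - b)) = 0 := by
    rw [← Matrix.vecMul_transpose, ← Matrix.dotProduct_mulVec, Matrix.vecMul_transpose,
      Matrix.mulVec_mulVec, h0, dotProduct_zero]
  exact sub_eq_zero.1 (h _ (dotProduct_self_eq_zero.1 h1))

lemma perpProj_transpose (Z : Matrix (Fin n) (Fin p) ℝ) : (perpProj Z)ᵀ = perpProj Z := by
  simp [perpProj, Matrix.transpose_sub, Matrix.transpose_mul, Matrix.transpose_nonsing_inv,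
    Matrix.mul_assoc]

lemma perpProj_mul_self {Z : Matrix (Fin n) (Fin p) ℝ} (hZ : IsUnit (Zᵀ * Z).det) :
    perpProj Z * Z = 0 := by
  rw [perpProj, Matrix.sub_mul, Matrix.one_mul, Matrix.mul_assoc, Matrix.mul_assoc,
    Matrix.nonsing_inv_mul _ hZ, Matrix.mul_one, sub_self]

lemma perpProj_mul_perpProj {Z : Matrix (Fin n) (Fin p) ℝ} (hZ : IsUnit (Zᵀ * Z).det) :
    perpProj Z * perpProj Z = perpProj Z := by
  nth_rw 2 [perpProj]
  rw [Matrix.mul_sub, Matrix.mul_one, ← Matrix.mul_assoc, ← Matrix.mul_assoc,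
    perpProj_mul_self hZ]
  simp

lemma perpProj_dotProduct (Z : Matrix (Fin n) (Fin p) ℝ) (x y : Fin n → ℝ) :
    (perpProj Z *ᵥ x) ⬝ᵥ y = x ⬝ᵥ (perpProj Z *ᵥ y) := by
  rw [Matrix.dotProduct_mulVec, ← Matrix.mulVec_transpose, perpProj_transpose]

lemma precision_eq_dotProduct {Z : Matrix (Fin n) (Fin p) ℝ} (hZ : IsUnit (Zᵀ * Z).det)
    (x : Fin n → ℝ) : precision Z x = (perpProj Z *ᵥ x) ⬝ᵥ (perpProj Z *ᵥ x) := by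
  rw [perpProj_dotProduct, Matrix.mulVec_mulVec, perpProj_mul_perpProj hZ, precision]

lemma dotProduct_sq_le (x y : Fin n → ℝ) : (x ⬝ᵥ y) ^ 2 ≤ (x ⬝ᵥ x) * (y ⬝ᵥ y) := by
  simpa [dotProduct, sq] using Finset.sum_mul_sq_le_sq_mul_sq Finset.univ x y

lemma dotProduct_self_nonneg' (x : Fin n → ℝ) : 0 ≤ x ⬝ᵥ x :=
  Finset.sum_nonneg fun i _ => mul_self_nonneg (x i)

lemma precision_le_dotProduct {Z : Matrix (Fin n) (Fin p) ℝ} (hZ : IsUnit (Zᵀ * Z).det)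
    (x : Fin n → ℝ) : precision Z x ≤ x ⬝ᵥ x := by
  have h1 : (x ⬝ᵥ (perpProj Z *ᵥ x)) ^ 2
      ≤ (x ⬝ᵥ x) * ((perpProj Z *ᵥ x) ⬝ᵥ (perpProj Z *ᵥ x)) := dotProduct_sq_le _ _
  have h2 := precision_eq_dotProduct hZ x
  have h3 : 0 ≤ (perpProj Z *ᵥ x) ⬝ᵥ (perpProj Z *ᵥ x) := dotProduct_self_nonneg' _
  have h4 := dotProduct_self_nonneg' x
  rw [← h2] at h1 h3
  change precision Z x ^ 2 ≤ _ at h1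
  nlinarith

lemma precision_nonneg {Z : Matrix (Fin n) (Fin p) ℝ} (hZ : IsUnit (Zᵀ * Z).det)
    (x : Fin n → ℝ) : 0 ≤ precision Z x := by
  rw [precision_eq_dotProduct hZ]; exact dotProduct_self_nonneg' _

lemma perpProj_orthogonal_mul (Z : Matrix (Fin n) (Fin p) ℝ) {R : Matrix (Fin n) (Fin n) ℝ}
    (hR : Rᵀ * R = 1) : perpProj (R * Z) = R * perpProj Z * Rᵀ := by
  have hR' : R * Rᵀ = 1 := mul_eq_one_comm.1 hR
  have h : (R * Z)ᵀ * (R * Z) = Zᵀ * Z := by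
    rw [Matrix.transpose_mul, Matrix.mul_assoc, ← Matrix.mul_assoc Rᵀ, hR, Matrix.one_mul]
  rw [perpProj, perpProj, h, Matrix.mul_sub, Matrix.sub_mul, Matrix.mul_one, hR',
    Matrix.transpose_mul]
  simp only [Matrix.mul_assoc]

lemma mem_range_of_perpProj_mulVec_eq_zero {Z : Matrix (Fin n) (Fin p) ℝ} {x : Fin n → ℝ}
    (h : perpProj Z *ᵥ x = 0) : ∃ a, x = Z *ᵥ a := by
  refine ⟨(Zᵀ * Z)⁻¹ *ᵥ (Zᵀ *ᵥ x), ?_⟩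
  rw [perpProj, Matrix.sub_mulVec, Matrix.one_mulVec, sub_eq_zero] at h
  rw [Matrix.mulVec_mulVec, Matrix.mulVec_mulVec]
  exact h

lemma regMatrix_mulVec (Z : Matrix (Fin n) (Fin p) ℝ) (x : Fin n → ℝ) (v : Fin (p + 1) → ℝ) :
    regMatrix Z x *ᵥ v = v 0 • x + Z *ᵥ Fin.tail v := by
  ext i
  simp [regMatrix, Matrix.mulVec, dotProduct, Fin.sum_univ_succ, Fin.tail, mul_comm]

/-- The Frisch–Waugh–Lovell formula: the coefficient of `x` is obtained by regressing `y` on the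
residual `P x`. -/
lemma olsBeta_eq {Z : Matrix (Fin n) (Fin p) ℝ} (hZ : IsUnit (Zᵀ * Z).det) {x : Fin n → ℝ}
    (hx : 0 < precision Z x) (y : Fin n → ℝ) :
    olsBeta Z x y = (precision Z x)⁻¹ * ((perpProj Z *ᵥ x) ⬝ᵥ y) := by
  set W := regMatrix Z x with hW
  set s := precision Z x with hs
  have hPZ : ∀ v, perpProj Z *ᵥ (Z *ᵥ v) = 0 := fun v => by
    rw [Matrix.mulVec_mulVec, perpProj_mul_self hZ, Matrix.zero_mulVec]
  have hWdet : IsUnit (Wᵀ * W).det := by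
    refine isUnit_det_of_injective W fun v hv => ?_
    rw [hW, regMatrix_mulVec] at hv
    have h0 : v 0 = 0 := by
      have h1 : x ⬝ᵥ (perpProj Z *ᵥ (v 0 • x + Z *ᵥ Fin.tail v)) = v 0 * s := by
        rw [Matrix.mulVec_add, hPZ, add_zero, Matrix.mulVec_smul, dotProduct_smul, smul_eq_mul]
        rfl
      rw [hv, Matrix.mulVec_zero, dotProduct_zero] at h1
      exact (mul_eq_zero.1 h1.symm).resolve_right hx.ne'
    rw [h0, zero_smul, zero_add] at hv
    have h2 : Fin.tail v = 0 := by
      have h3 : (Zᵀ * Z) *ᵥ Fin.tail v = 0 := by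
        rw [← Matrix.mulVec_mulVec, hv, Matrix.mulVec_zero]
      exact Matrix.mulVec_injective_iff_isUnit.2
        ((Matrix.isUnit_iff_isUnit_det _).2 hZ) (h3.trans (Matrix.mulVec_zero _).symm)
    ext i
    refine Fin.cases h0 (fun j => ?_) i
    exact congrFun h2 j
  -- `v` is the first column of `(Wᵀ W)⁻¹`
  set v : Fin (p + 1) → ℝ := s⁻¹ • Fin.cons 1 (-((Zᵀ * Z)⁻¹ *ᵥ (Zᵀ *ᵥ x))) with hv
  have hWv : W *ᵥ v = s⁻¹ • (perpProj Z *ᵥ x) := by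
    rw [hv, Matrix.mulVec_smul, hW, regMatrix_mulVec]
    congr 1
    rw [Fin.cons_zero, one_smul, Fin.tail_cons, perpProj, Matrix.sub_mulVec, Matrix.one_mulVec,
      Matrix.mulVec_neg, Matrix.mulVec_mulVec, Matrix.mulVec_mulVec, sub_eq_add_neg]
  have hWW : (Wᵀ * W) *ᵥ v = Pi.single 0 1 := by
    rw [← Matrix.mulVec_mulVec, hWv, Matrix.mulVec_smul]
    ext i
    refine Fin.cases ?_ (fun j => ?_) i
    · have : (Wᵀ *ᵥ (perpProj Z *ᵥ x)) 0 = s := rfl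
      rw [Pi.smul_apply, this, smul_eq_mul, Pi.single_eq_same, inv_mul_cancel₀ hx.ne']
    · have : (Wᵀ *ᵥ (perpProj Z *ᵥ x)) j.succ = (Zᵀ *ᵥ (perpProj Z *ᵥ x)) j := rfl
      have h0 : Zᵀ *ᵥ (perpProj Z *ᵥ x) = 0 := by
        rw [Matrix.mulVec_mulVec, ← perpProj_transpose, ← Matrix.transpose_mul,
          perpProj_mul_self hZ]
        simp
      rw [Pi.smul_apply, this, h0, Pi.zero_apply, smul_zero,
        Pi.single_eq_of_ne (Fin.succ_ne_zero j)]
  have hinv : (Wᵀ * W)⁻¹ *ᵥ (Pi.single 0 1) = v := by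
    rw [← hWW, Matrix.mulVec_mulVec, Matrix.nonsing_inv_mul _ hWdet, Matrix.one_mulVec]
  have hsymm : ((Wᵀ * W)⁻¹)ᵀ = (Wᵀ * W)⁻¹ := by
    rw [Matrix.transpose_nonsing_inv, Matrix.transpose_mul, Matrix.transpose_transpose]
  calc olsBeta Z x y = (Pi.single 0 1) ⬝ᵥ ((Wᵀ * W)⁻¹ *ᵥ (Wᵀ *ᵥ y)) := by
        rw [single_one_dotProduct]; rfl
    _ = v ⬝ᵥ (Wᵀ *ᵥ y) := by
        rw [Matrix.dotProduct_mulVec, ← Matrix.mulVec_transpose, hsymm, hinv]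
    _ = (W *ᵥ v) ⬝ᵥ y := by
        rw [Matrix.dotProduct_mulVec, Matrix.vecMul_transpose]
    _ = _ := by rw [hWv, smul_dotProduct, smul_eq_mul]

lemma olsBeta_response {Z : Matrix (Fin n) (Fin p) ℝ} (hZ : IsUnit (Zᵀ * Z).det)
    {x : Fin n → ℝ} (hx : 0 < precision Z x) (β : ℝ) (γ : Fin p → ℝ) (e : Fin n → ℝ) :
    olsBeta Z x (response Z x β γ e)
      = β + ∑ i, ((precision Z x)⁻¹ * (perpProj Z *ᵥ x) i) * e i := by
  have hr : response Z x β γ e = β • x + Z *ᵥ γ + e := by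
    ext i
    simp [response, Matrix.mulVec, dotProduct_comm]
  have h1 : (perpProj Z *ᵥ x) ⬝ᵥ x = precision Z x := by rw [dotProduct_comm]; rfl
  have h2 : (perpProj Z *ᵥ x) ⬝ᵥ (Z *ᵥ γ) = 0 := by
    rw [perpProj_dotProduct, Matrix.mulVec_mulVec, perpProj_mul_self hZ]; simp
  rw [olsBeta_eq hZ hx, hr, dotProduct_add, dotProduct_add, h2, dotProduct_smul, h1]
  simp only [dotProduct, smul_eq_mul, mul_assoc, ← Finset.mul_sum]
  field_simp
  ring

lemma variance_const_add_sum {Ω : Type*} [MeasurableSpace Ω] {μ : Measure Ω}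
    [IsProbabilityMeasure μ] {ε : Fin n → Ω → ℝ} (hε : IsWhiteNoise ε μ) (b : ℝ)
    (a : Fin n → ℝ) : variance (fun ω => b + ∑ i, a i * ε i ω) μ = a ⬝ᵥ a := by
  obtain ⟨hL, -, hcov⟩ := hε
  have hm : ∀ i, MemLp (fun ω => a i * ε i ω) 2 μ := fun i => (hL i).const_mul (a i)
  rw [variance_const_add (Finset.aestronglyMeasurable_fun_sum _ fun i _ => (hm i).1),
    variance_fun_sum hm]
  simp [covariance_const_mul_left, covariance_const_mul_right, hcov, dotProduct]

lemma variance_olsBeta {Z : Matrix (Fin n) (Fin p) ℝ} (hZ : IsUnit (Zᵀ * Z).det)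
    {x : Fin n → ℝ} (hx : 0 < precision Z x) {Ω : Type*} [MeasurableSpace Ω] {μ : Measure Ω}
    [IsProbabilityMeasure μ] {ε : Fin n → Ω → ℝ} (hε : IsWhiteNoise ε μ) (β : ℝ)
    (γ : Fin p → ℝ) :
    variance (fun ω => olsBeta Z x (response Z x β γ fun i => ε i ω)) μ = (precision Z x)⁻¹ := by
  simp_rw [olsBeta_response hZ hx]
  rw [variance_const_add_sum hε]
  have h := precision_eq_dotProduct hZ x
  simp only [dotProduct] at h ⊢
  have : ∀ i, (precision Z x)⁻¹ * (perpProj Z *ᵥ x) i * ((precision Z x)⁻¹ * (perpProj Z *ᵥ x) i)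
    = (precision Z x)⁻¹ ^ 2 * ((perpProj Z *ᵥ x) i * (perpProj Z *ᵥ x) i) := fun i => by ring
  simp_rw [this]
  rw [← Finset.mul_sum, ← h]
  field_simp

end LinearAlgebra

/-! ### Gaussian vectors -/

/-- The standard Gaussian measure on `Fin n → ℝ`, the law of one covariate across the `n` users. -/
noncomputable def gaussianVector (n : ℕ) : Measure (Fin n → ℝ) :=
  Measure.pi fun _ => gaussianReal 0 1

instance (n : ℕ) : IsProbabilityMeasure (gaussianVector n) := by
  unfold gaussianVector; infer_instance

instance (n d : ℕ) : IsProbabilityMeasure (gaussianCovariates n d) := by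
  unfold gaussianCovariates; infer_instance

section Gaussian

variable {n : ℕ}

@[fun_prop]
lemma measurable_dotProduct {α : Type*} [MeasurableSpace α] {f g : α → Fin n → ℝ}
    (hf : Measurable f) (hg : Measurable g) : Measurable fun a => f a ⬝ᵥ g a := by
  unfold dotProduct
  fun_prop

@[fun_prop]
lemma measurable_mulVec {m : ℕ} {α : Type*} [MeasurableSpace α]
    {A : α → Matrix (Fin m) (Fin n) ℝ} {f : α → Fin n → ℝ} (hA : ∀ i j, Measurable fun a => A a i j)
    (hf : Measurable f) : Measurable fun a => A a *ᵥ f a := by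
  refine measurable_pi_lambda _ fun i => ?_
  have : Measurable fun a => ∑ j, A a i j * f a j :=
    Finset.measurable_fun_sum _ fun j _ => (hA i j).mul ((measurable_pi_apply j).comp hf)
  exact this

/-- A finite measure on `Fin n → ℝ` is determined by its characteristic function. -/
lemma ext_of_integral_cexp_dotProduct {μ ν : Measure (Fin n → ℝ)} [IsFiniteMeasure μ]
    [IsFiniteMeasure ν]
    (h : ∀ t : Fin n → ℝ, ∫ x, Complex.exp ((t ⬝ᵥ x : ℝ) * Complex.I) ∂μ
      = ∫ x, Complex.exp ((t ⬝ᵥ x : ℝ) * Complex.I) ∂ν) : μ = ν := by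
  have key : ∀ (ρ : Measure (Fin n → ℝ)) (t : EuclideanSpace ℝ (Fin n)),
      charFun (ρ.map (WithLp.toLp 2)) t
        = ∫ x, Complex.exp ((t.ofLp ⬝ᵥ x : ℝ) * Complex.I) ∂ρ := by
    intro ρ t
    rw [charFun_apply, integral_map (by fun_prop) (by fun_prop)]
    rfl
  have h1 : μ.map (MeasurableEquiv.toLp 2 (Fin n → ℝ))
      = ν.map (MeasurableEquiv.toLp 2 (Fin n → ℝ)) := by
    rw [MeasurableEquiv.coe_toLp]
    refine Measure.ext_of_charFun (funext fun t => ?_)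
    rw [key, key, h]
  exact (MeasurableEquiv.toLp 2 (Fin n → ℝ)).map_measurableEquiv_injective h1

lemma integral_cexp_dotProduct_gaussianVector (t : Fin n → ℝ) :
    ∫ x, Complex.exp ((t ⬝ᵥ x : ℝ) * Complex.I) ∂(gaussianVector n)
      = Complex.exp (-((t ⬝ᵥ t : ℝ) : ℂ) / 2) := by
  have h : ∀ x : Fin n → ℝ, Complex.exp ((t ⬝ᵥ x : ℝ) * Complex.I)
      = ∏ i, Complex.exp (t i * x i * Complex.I) := by
    intro x
    rw [← Complex.exp_sum, ← Finset.sum_mul]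
    simp [dotProduct]
  simp_rw [h]
  rw [gaussianVector, integral_fintype_prod_eq_prod (𝕜 := ℂ)
    (fun i (y : ℝ) => Complex.exp (t i * y * Complex.I))]
  simp_rw [← charFun_apply_real, charFun_gaussianReal]
  rw [← Complex.exp_sum]
  congr 1
  simp [dotProduct, ← Finset.sum_div, sq, neg_div]

lemma map_dotProduct_gaussianVector (a : Fin n → ℝ) :
    (gaussianVector n).map (fun x => a ⬝ᵥ x) = gaussianReal 0 (a ⬝ᵥ a).toNNReal := by
  have : IsProbabilityMeasure ((gaussianVector n).map (fun x => a ⬝ᵥ x)) :=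
    Measure.isProbabilityMeasure_map (by fun_prop)
  refine Measure.ext_of_charFun (funext fun t => ?_)
  rw [charFun_apply_real, integral_map (by fun_prop) (by fun_prop), charFun_gaussianReal]
  have h : ∀ x : Fin n → ℝ, (t : ℂ) * ((a ⬝ᵥ x : ℝ) : ℂ) = (((t • a) ⬝ᵥ x : ℝ) : ℂ) := by
    intro x; simp
  simp_rw [h]
  rw [integral_cexp_dotProduct_gaussianVector]
  congr 1
  simp [Real.coe_toNNReal _ (dotProduct_self_nonneg' a)]
  ring

lemma measurePreserving_mulVec_gaussianVector {R : Matrix (Fin n) (Fin n) ℝ} (hR : Rᵀ * R = 1) :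
    MeasurePreserving (fun x => R *ᵥ x) (gaussianVector n) (gaussianVector n) := by
  have hm : Measurable (fun x : Fin n → ℝ => R *ᵥ x) := by fun_prop
  refine ⟨hm, ?_⟩
  have : IsProbabilityMeasure ((gaussianVector n).map (fun x => R *ᵥ x)) :=
    Measure.isProbabilityMeasure_map hm.aemeasurable
  refine ext_of_integral_cexp_dotProduct fun t => ?_
  rw [integral_map hm.aemeasurable (Measurable.aestronglyMeasurable (by fun_prop))]
  simp_rw [Matrix.dotProduct_mulVec]
  rw [integral_cexp_dotProduct_gaussianVector, integral_cexp_dotProduct_gaussianVector,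
    ← Matrix.dotProduct_mulVec, ← Matrix.mulVec_transpose, Matrix.mulVec_mulVec,
    mul_eq_one_comm.1 hR, Matrix.one_mulVec]

/-- A proper subspace is a null set, since it lies in a hyperplane `a ⬝ᵥ x = 0` and `a ⬝ᵥ x` is a
nondegenerate Gaussian variable. -/
lemma ae_notMem_of_ne_top {S : Submodule ℝ (Fin n → ℝ)} (hS : S ≠ ⊤) :
    ∀ᵐ x ∂(gaussianVector n), x ∉ S := by
  obtain ⟨f, hf, hfS⟩ := Submodule.exists_le_ker_of_lt_top S hS.lt_top
  set a : Fin n → ℝ := fun i => f (Pi.single i 1) with ha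
  have hfa : ∀ x, f x = a ⬝ᵥ x := by
    intro x
    rw [LinearMap.pi_apply_eq_sum_univ f x]
    simp [dotProduct, ha, mul_comm]
    refine Finset.sum_congr rfl fun i _ => ?_
    congr 2
    ext j
    simp [Pi.single_apply, eq_comm]
  have hane : a ≠ 0 := by
    intro h0
    apply hf
    ext i
    simpa [ha] using congrFun h0 i
  have hv : (a ⬝ᵥ a).toNNReal ≠ 0 := by
    intro h0
    exact hane (dotProduct_self_eq_zero.1
      (le_antisymm (Real.toNNReal_eq_zero.1 h0) (dotProduct_self_nonneg' a)))
  have hnull : gaussianReal 0 (a ⬝ᵥ a).toNNReal {0} = 0 := by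
    have := gaussianReal_absolutelyContinuous 0 hv
    exact this (by simp)
  rw [← map_dotProduct_gaussianVector, Measure.map_apply (by fun_prop) (by simp)] at hnull
  refine measure_mono_null ?_ hnull
  intro x hx
  have hx' : x ∈ S := by simpa using hx
  have := hfS hx'
  rw [LinearMap.mem_ker, hfa] at this
  simpa using this

/-- Independent Gaussian columns almost surely stay linearly independent under a surjective linear map onto a
space of dimension at least their number. -/
lemma ae_linearIndependent_comp {q : ℕ} (T : (Fin n → ℝ) →ₗ[ℝ] (Fin q → ℝ))
    (hT : Function.Surjective T) (d : ℕ) (hd : d ≤ q) :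
    ∀ᵐ C ∂(Measure.pi fun _ : Fin d => gaussianVector n),
      LinearIndependent ℝ (fun j => T (C j)) := by
  induction d with
  | zero => exact Filter.Eventually.of_forall fun C => linearIndependent_empty_type
  | succ d ih =>
    have ih := ih (by omega)
    have hTm : Continuous T := T.continuous_of_finiteDimensional
    have hmp := measurePreserving_piFinSuccAbove (fun _ : Fin (d + 1) => gaussianVector n) 0
    have hmeas : MeasurableSet {p : (Fin n → ℝ) × (Fin d → Fin n → ℝ) |
        LinearIndependent ℝ (Fin.cons (T p.1) fun j => T (p.2 j) : Fin (d + 1) → Fin q → ℝ)} := by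
      have hc : Continuous fun p : (Fin n → ℝ) × (Fin d → Fin n → ℝ) =>
          (Fin.cons (T p.1) fun j => T (p.2 j) : Fin (d + 1) → Fin q → ℝ) := by
        refine continuous_pi fun j => ?_
        refine Fin.cases ?_ (fun j => ?_) j
        · exact hTm.comp continuous_fst
        · exact hTm.comp ((continuous_apply j).comp continuous_snd)
      exact (isOpen_setOfPred_linearIndependent.preimage hc).measurableSet
    have hprod : ∀ᵐ p ∂((gaussianVector n).prod (Measure.pi fun _ : Fin d => gaussianVector n)),
        LinearIndependent ℝ (Fin.cons (T p.1) fun j => T (p.2 j) : Fin (d + 1) → Fin q → ℝ) := by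
      rw [← Measure.prod_swap, ae_map_iff (by fun_prop) hmeas]
      refine (Measure.ae_prod_iff_ae_ae (measurable_swap hmeas)).2 ?_
      filter_upwards [ih] with C hC
      have hne : (Submodule.span ℝ (Set.range fun j => T (C j))).comap T ≠ ⊤ := by
        intro htop
        have h1 : Submodule.span ℝ (Set.range fun j => T (C j)) = ⊤ := by
          rw [eq_top_iff]
          intro y _
          obtain ⟨x, rfl⟩ := hT y
          have : x ∈ (Submodule.span ℝ (Set.range fun j => T (C j))).comap T := by
            rw [htop]; trivial
          exact this
        have h2 := finrank_span_eq_card hC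
        rw [h1, finrank_top] at h2
        simp at h2
        omega
      filter_upwards [ae_notMem_of_ne_top hne] with c hc
      exact linearIndependent_finCons.2 ⟨hC, hc⟩
    have := hmp.quasiMeasurePreserving.ae hprod
    filter_upwards [this] with C hC
    convert hC using 1
    ext j
    refine Fin.cases ?_ (fun j => ?_) j
    · rfl
    · rfl

/-- The covariates seen column by column are independent Gaussian vectors. -/
lemma measurePreserving_transpose_gaussianCovariates (n d : ℕ) :
    MeasurePreserving (fun (G : Fin n → Fin d → ℝ) j i => G i j) (gaussianCovariates n d)
      (Measure.pi fun _ : Fin d => gaussianVector n) := by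
  have key : ∀ a b : ℕ, (Measure.pi fun _ : Fin a × Fin b => gaussianReal 0 1).map
      (MeasurableEquiv.curry (Fin a) (Fin b) ℝ)
      = Measure.pi fun _ : Fin a => Measure.pi fun _ : Fin b => gaussianReal 0 1 := by
    intro a b
    have := Measure.infinitePi_map_curry (fun (_ : Fin a) (_ : Fin b) => gaussianReal 0 1)
    simpa only [Measure.infinitePi_eq_pi] using this
  have hs : (Measure.pi fun _ : Fin n × Fin d => gaussianReal 0 1).map
      (MeasurableEquiv.piCongrLeft (fun _ => ℝ) (Equiv.prodComm (Fin n) (Fin d)))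
      = Measure.pi fun _ : Fin d × Fin n => gaussianReal 0 1 :=
    (measurePreserving_piCongrLeft (fun _ : Fin d × Fin n => gaussianReal 0 1)
      (Equiv.prodComm (Fin n) (Fin d))).map_eq
  refine ⟨by fun_prop, ?_⟩
  unfold gaussianVector gaussianCovariates
  rw [← key d n, ← hs, ← key n d, Measure.map_map (by fun_prop) (by fun_prop),
    Measure.map_map (by fun_prop) (by fun_prop)]
  congr 1

end Gaussian

/-! ### Full rank of the data matrix -/

section Rank

variable {n d : ℕ}

lemma dataMatrix_mulVec (G : Fin n → Fin d → ℝ) (v : Fin (d + 1) → ℝ) :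
    dataMatrix G *ᵥ v = ∑ j : Fin d, v j.castSucc • (fun i => G i j) + v (Fin.last d) • 1 := by
  ext i
  simp [dataMatrix, Matrix.mulVec, dotProduct, Fin.sum_univ_castSucc, mul_comm]

/-- Almost surely the covariate columns are linearly independent modulo a fixed subspace, as long
as the dimensions permit. -/
lemma ae_eq_zero_of_sum_mem (S : Submodule ℝ (Fin n → ℝ)) (hS : Module.finrank ℝ S + d ≤ n) :
    ∀ᵐ G ∂(gaussianCovariates n d), ∀ b : Fin d → ℝ,
      ∑ j, b j • (fun i => G i j) ∈ S → b = 0 := by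
  set q := Module.finrank ℝ ((Fin n → ℝ) ⧸ S) with hq
  have hqd : d ≤ q := by
    have := S.finrank_quotient_add_finrank
    simp at this
    omega
  have e : ((Fin n → ℝ) ⧸ S) ≃ₗ[ℝ] (Fin q → ℝ) :=
    LinearEquiv.ofFinrankEq _ _ (by simp [hq])
  have hae := ae_linearIndependent_comp (e.toLinearMap ∘ₗ S.mkQ)
    (e.surjective.comp S.mkQ_surjective) d hqd
  have := (measurePreserving_transpose_gaussianCovariates n d).quasiMeasurePreserving.ae hae
  filter_upwards [this] with G hG b hb
  rw [Fintype.linearIndependent_iff] at hG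
  ext j
  refine hG b ?_ j
  have h0 : (e.toLinearMap ∘ₗ S.mkQ) (∑ j, b j • (fun i => G i j)) = 0 := by
    simp only [LinearMap.comp_apply]
    rw [(Submodule.Quotient.mk_eq_zero S).2 hb |> fun h => (show S.mkQ _ = 0 from h), map_zero]
  simpa [map_sum] using h0

lemma ae_isUnit_det (h : d + 1 ≤ n) :
    ∀ᵐ G ∂(gaussianCovariates n d), IsUnit ((dataMatrix G)ᵀ * dataMatrix G).det := by
  have hS : Module.finrank ℝ (Submodule.span ℝ {(1 : Fin n → ℝ)}) ≤ 1 := by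
    simpa using finrank_span_le_card (R := ℝ) ({1} : Set (Fin n → ℝ))
  filter_upwards [ae_eq_zero_of_sum_mem (d := d) (Submodule.span ℝ {(1 : Fin n → ℝ)}) (by omega)]
    with G hG
  refine isUnit_det_of_injective _ fun v hv => ?_
  rw [dataMatrix_mulVec] at hv
  have hb := hG (fun j => v j.castSucc) (by
    rw [eq_neg_of_add_eq_zero_left hv]
    exact Submodule.neg_mem _ (Submodule.smul_mem _ _ (Submodule.mem_span_singleton_self _)))
  have hlast : v (Fin.last d) = 0 := by
    have : (fun j : Fin d => v j.castSucc) = 0 := hb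
    simp only [congrFun this _, Pi.zero_apply, zero_smul, Finset.sum_const_zero, zero_add] at hv
    have := congrFun hv ⟨0, by omega⟩
    simpa using this
  ext j
  refine Fin.lastCases hlast (fun j => congrFun hb j) j

lemma ae_precision_pos (h : d + 2 ≤ n) {x : Fin n → ℝ} (hx : ¬ ∃ a : ℝ, x = a • 1) :
    ∀ᵐ G ∂(gaussianCovariates n d), 0 < precision (dataMatrix G) x := by
  have hS : Module.finrank ℝ (Submodule.span ℝ (Set.range ![(1 : Fin n → ℝ), x])) ≤ 2 := by
    simpa [Set.finrank] using finrank_range_le_card (R := ℝ) ![(1 : Fin n → ℝ), x]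
  have h1 : (1 : Fin n → ℝ) ∈ Submodule.span ℝ (Set.range ![(1 : Fin n → ℝ), x]) :=
    Submodule.subset_span ⟨0, rfl⟩
  have h2 : x ∈ Submodule.span ℝ (Set.range ![(1 : Fin n → ℝ), x]) :=
    Submodule.subset_span ⟨1, rfl⟩
  filter_upwards [ae_isUnit_det (by omega : d + 1 ≤ n),
    ae_eq_zero_of_sum_mem (d := d) _ (by omega : Module.finrank ℝ (Submodule.span ℝ
      (Set.range ![(1 : Fin n → ℝ), x])) + d ≤ n)] with G hdet hG
  refine (precision_nonneg hdet x).lt_of_ne fun h0 => ?_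
  rw [precision_eq_dotProduct hdet] at h0
  obtain ⟨a, ha⟩ := mem_range_of_perpProj_mulVec_eq_zero (dotProduct_self_eq_zero.1 h0.symm)
  rw [dataMatrix_mulVec] at ha
  have hb : (fun j : Fin d => a j.castSucc) = 0 := hG (fun j => a j.castSucc) (by
    rw [← sub_eq_iff_eq_add.2 ha]
    exact Submodule.sub_mem _ h2 (Submodule.smul_mem _ _ h1))
  simp only [congrFun hb _, Pi.zero_apply, zero_smul, Finset.sum_const_zero, zero_add] at ha
  exact hx ⟨_, ha⟩

end Rank

/-! ### Isotropic random directions orthogonal to the ones vector -/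

section Isotropy

variable {n : ℕ}

/-- The vector with its mean subtracted: its orthogonal projection on the complement of the
ones vector (for `n ≠ 0`). -/
noncomputable def center (h : Fin n → ℝ) : Fin n → ℝ := h - ((1 ⬝ᵥ h) / n) • 1

@[fun_prop]
lemma measurable_center : Measurable (center : (Fin n → ℝ) → Fin n → ℝ) := by
  have : Measurable fun h : Fin n → ℝ => (1 ⬝ᵥ h) / (n : ℝ) := by fun_prop
  refine measurable_pi_lambda _ fun i => ?_
  simp only [center, Pi.sub_apply, Pi.smul_apply, smul_eq_mul]
  fun_prop

lemma one_dotProduct_center [NeZero n] (h : Fin n → ℝ) : 1 ⬝ᵥ center h = 0 := by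
  have : (n : ℝ) ≠ 0 := by exact_mod_cast NeZero.ne n
  simp [center, dotProduct_sub, this]

lemma center_dotProduct_of_orthogonal (s : Fin n → ℝ) {u : Fin n → ℝ} (hu : 1 ⬝ᵥ u = 0) :
    center s ⬝ᵥ u = s ⬝ᵥ u := by
  simp [center, sub_dotProduct, hu]

lemma dotProduct_center (s h : Fin n → ℝ) : s ⬝ᵥ center h = center s ⬝ᵥ h := by
  simp only [center, sub_dotProduct, dotProduct_sub, smul_dotProduct, dotProduct_smul, smul_eq_mul,
    dotProduct_comm s 1]
  ring

lemma dotProduct_center_eq (x h : Fin n → ℝ) :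
    x ⬝ᵥ center h = x ⬝ᵥ h - (1 ⬝ᵥ x) * (1 ⬝ᵥ h) / n := by
  simp only [center, dotProduct_sub, dotProduct_smul, smul_eq_mul, dotProduct_comm x 1]
  ring

/-- The reflection exchanging two vectors of equal length fixes what is orthogonal to both. -/
lemma exists_orthogonal_mulVec_eq {a b : Fin n → ℝ} (ha : 1 ⬝ᵥ a = 0) (hb : 1 ⬝ᵥ b = 0)
    (hab : a ⬝ᵥ a = b ⬝ᵥ b) :
    ∃ R : Matrix (Fin n) (Fin n) ℝ, Rᵀ * R = 1 ∧ R *ᵥ 1 = 1 ∧ R *ᵥ a = b := by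
  by_cases hv : a - b = 0
  · exact ⟨1, by simp, by simp, by simpa using sub_eq_zero.1 hv⟩
  set v := a - b with hvdef
  have hvv : v ⬝ᵥ v ≠ 0 := fun h => hv (dotProduct_self_eq_zero.1 h)
  set R : Matrix (Fin n) (Fin n) ℝ := 1 - (2 / (v ⬝ᵥ v)) • Matrix.vecMulVec v v with hR
  have hRx : ∀ x, R *ᵥ x = x - (2 / (v ⬝ᵥ v) * (v ⬝ᵥ x)) • v := by
    intro x
    rw [hR, Matrix.sub_mulVec, Matrix.one_mulVec, Matrix.smul_mulVec, Matrix.vecMulVec_mulVec]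
    simp [smul_smul]
  have hRt : Rᵀ = R := by
    rw [hR]
    ext i j
    simp [Matrix.vecMulVec_apply, Matrix.one_apply, mul_comm, eq_comm]
  refine ⟨R, ?_, ?_, ?_⟩
  · rw [hRt]
    refine Matrix.ext_of_mulVec_single fun i => ?_
    have h1 : v ⬝ᵥ (R *ᵥ Pi.single i 1) = -(v ⬝ᵥ Pi.single i 1) := by
      have : v ⬝ᵥ ((2 / (v ⬝ᵥ v) * (v ⬝ᵥ Pi.single i 1)) • v) = 2 * (v ⬝ᵥ Pi.single i 1) := by
        rw [dotProduct_smul, smul_eq_mul]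
        field_simp
      rw [hRx, dotProduct_sub v, this]
      ring
    rw [← Matrix.mulVec_mulVec, hRx, h1, hRx, Matrix.one_mulVec, mul_neg, neg_smul, sub_neg_eq_add,
      sub_add_cancel]
  · have h1 : v ⬝ᵥ 1 = 0 := by rw [dotProduct_comm, hvdef, dotProduct_sub 1, ha, hb, sub_zero]
    rw [hRx, h1]
    simp
  · rw [hRx]
    have h1 : 2 * (v ⬝ᵥ a) = v ⬝ᵥ v := by
      simp only [hvdef, sub_dotProduct, dotProduct_sub, dotProduct_comm b a]
      linarith
    have h2 : 2 / (v ⬝ᵥ v) * (v ⬝ᵥ a) = 1 := by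
      rw [div_mul_eq_mul_div, h1, div_self hvv]
    rw [h2, one_smul, hvdef]
    abel

lemma integrable_cexp_mul_I {α : Type*} [MeasurableSpace α] {μ : Measure α} [IsFiniteMeasure μ]
    {f : α → ℝ} (hf : Measurable f) :
    Integrable (fun a => Complex.exp ((f a : ℂ) * Complex.I)) μ := by
  refine Integrable.of_bound (C := 1) (Measurable.aestronglyMeasurable (by fun_prop)) ?_
  exact Filter.Eventually.of_forall fun a => by rw [Complex.norm_exp_ofReal_mul_I]

/-- A random vector `u` that is a unit vector orthogonal to the ones vector, with a law invariant
under the orthogonal maps fixing the ones vector, becomes a centered Gaussian vector once scaled by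
the length of an independent one. The characteristic function of `u` depends only on length, so
the roles of the argument `t` and of the Gaussian vector can be exchanged. -/
theorem map_norm_smul_eq_map_center [NeZero n] {ν : Measure (Fin n → ℝ)} [IsProbabilityMeasure ν]
    (hinv : ∀ R : Matrix (Fin n) (Fin n) ℝ, Rᵀ * R = 1 → R *ᵥ 1 = 1 →
      ν.map (fun u => R *ᵥ u) = ν)
    (hone : ∀ᵐ u ∂ν, 1 ⬝ᵥ u = 0) (hunit : ∀ᵐ u ∂ν, u ⬝ᵥ u = 1) :
    (ν.prod (gaussianVector n)).map (fun p => √(center p.2 ⬝ᵥ center p.2) • p.1)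
      = (gaussianVector n).map center := by
  have hm1 : Measurable (fun p : (Fin n → ℝ) × (Fin n → ℝ) =>
      √(center p.2 ⬝ᵥ center p.2) • p.1) := by fun_prop
  have : IsProbabilityMeasure ((ν.prod (gaussianVector n)).map
    (fun p => √(center p.2 ⬝ᵥ center p.2) • p.1)) :=
    Measure.isProbabilityMeasure_map hm1.aemeasurable
  have : IsProbabilityMeasure ((gaussianVector n).map center) :=
    Measure.isProbabilityMeasure_map measurable_center.aemeasurable
  have hrad : ∀ a b : Fin n → ℝ, 1 ⬝ᵥ a = 0 → 1 ⬝ᵥ b = 0 → a ⬝ᵥ a = b ⬝ᵥ b →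
      ∫ u, Complex.exp ((a ⬝ᵥ u : ℝ) * Complex.I) ∂ν
        = ∫ u, Complex.exp ((b ⬝ᵥ u : ℝ) * Complex.I) ∂ν := by
    intro a b ha hb hab
    obtain ⟨R, hR, hR1, hRa⟩ := exists_orthogonal_mulVec_eq ha hb hab
    have hR' : R * Rᵀ = 1 := mul_eq_one_comm.1 hR
    have h1 : Rᵀ *ᵥ 1 = 1 := by
      conv_lhs => rw [← hR1]
      rw [Matrix.mulVec_mulVec, hR, Matrix.one_mulVec]
    have hmap := hinv Rᵀ (by rw [Matrix.transpose_transpose, hR']) h1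
    conv_lhs => rw [← hmap]
    rw [integral_map (Measurable.aemeasurable (by fun_prop))
      (Measurable.aestronglyMeasurable (by fun_prop))]
    simp_rw [Matrix.dotProduct_mulVec, Matrix.vecMul_transpose, hRa]
  refine ext_of_integral_cexp_dotProduct fun t => ?_
  rw [integral_map hm1.aemeasurable (Measurable.aestronglyMeasurable (by fun_prop)),
    integral_map measurable_center.aemeasurable (Measurable.aestronglyMeasurable (by fun_prop))]
  simp_rw [dotProduct_center t]
  rw [integral_cexp_dotProduct_gaussianVector]
  set r := √(center t ⬝ᵥ center t) with hr
  have hr2 : r * r = center t ⬝ᵥ center t := Real.mul_self_sqrt (dotProduct_self_nonneg' _)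
  calc ∫ p, Complex.exp ((t ⬝ᵥ (√(center p.2 ⬝ᵥ center p.2) • p.1) : ℝ) * Complex.I)
        ∂(ν.prod (gaussianVector n))
      = ∫ h, ∫ u, Complex.exp ((t ⬝ᵥ (√(center h ⬝ᵥ center h) • u) : ℝ) * Complex.I) ∂ν
          ∂(gaussianVector n) := integral_prod_symm _ (integrable_cexp_mul_I (by fun_prop))
    _ = ∫ h, ∫ u, Complex.exp (((r • center h) ⬝ᵥ u : ℝ) * Complex.I) ∂ν
          ∂(gaussianVector n) := by
        -- `|center h| • center t` and `|center t| • center h` have the same length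
        congr 1
        ext h
        set s := √(center h ⬝ᵥ center h) with hs
        have hs2 : s * s = center h ⬝ᵥ center h := Real.mul_self_sqrt (dotProduct_self_nonneg' _)
        rw [← hrad (s • center t) (r • center h) (by simp [one_dotProduct_center])
          (by simp [one_dotProduct_center]) (by
            simp only [smul_dotProduct, dotProduct_smul, smul_eq_mul]
            rw [← hs2, ← hr2]; ring)]
        refine integral_congr_ae ?_
        filter_upwards [hone] with u hu
        rw [smul_dotProduct, center_dotProduct_of_orthogonal t hu, dotProduct_smul]
    _ = ∫ u, ∫ h, Complex.exp (((r • center h) ⬝ᵥ u : ℝ) * Complex.I) ∂(gaussianVector n) ∂ν := by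
        refine integral_integral_swap ?_
        exact integrable_cexp_mul_I (f := fun p : (Fin n → ℝ) × (Fin n → ℝ) =>
          (r • center p.1) ⬝ᵥ p.2) (by fun_prop)
    _ = ∫ u, Complex.exp (-((center t ⬝ᵥ center t : ℝ) : ℂ) / 2) ∂ν := by
        refine integral_congr_ae ?_
        filter_upwards [hone, hunit] with u hu1 hu2
        have : ∀ h : Fin n → ℝ, (r • center h) ⬝ᵥ u = (r • u) ⬝ᵥ h := by
          intro h
          rw [smul_dotProduct, center_dotProduct_of_orthogonal h hu1, smul_dotProduct,
            dotProduct_comm]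
        simp_rw [this]
        rw [integral_cexp_dotProduct_gaussianVector, smul_dotProduct, dotProduct_smul, hu2, ← hr2]
        simp
    _ = _ := by simp

end Isotropy

/-! ### Reduction to a centered Gaussian vector -/

section Assignments

variable {n k : ℕ}

lemma finite_assignments (n k : ℕ) : (assignments n k).Finite := by
  refine (Set.Finite.pi' (t := fun _ : Fin n => ({0, 1} : Set ℝ)) fun _ => by simp).subset ?_
  intro x hx i
  simpa using hx.1 i

lemma one_dotProduct_of_mem {x : Fin n → ℝ} (hx : x ∈ assignments n k) : 1 ⬝ᵥ x = k := by
  simpa [dotProduct] using hx.2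

lemma dotProduct_self_of_mem {x : Fin n → ℝ} (hx : x ∈ assignments n k) : x ⬝ᵥ x = k := by
  rw [← hx.2]
  refine Finset.sum_congr rfl fun i _ => ?_
  rcases hx.1 i with h | h <;> simp [h]

lemma not_exists_eq_smul_one (hk : 1 ≤ k) (hkn : k < n) {x : Fin n → ℝ}
    (hx : x ∈ assignments n k) : ¬ ∃ a : ℝ, x = a • 1 := by
  rintro ⟨a, rfl⟩
  have h2 : (n : ℝ) * a = k := by simpa using hx.2
  have hk' : (1 : ℝ) ≤ k := by exact_mod_cast hk
  have hkn' : (k : ℝ) < n := by exact_mod_cast hkn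
  rcases hx.1 ⟨0, by omega⟩ with h | h <;> simp at h <;> subst h <;> linarith

/-- The largest value of `(x ⬝ᵥ w) ^ 2` over the assignments `x`. -/
noncomputable def maxSq (k : ℕ) (w : Fin n → ℝ) : ℝ :=
  sSup ((fun x => (x ⬝ᵥ w) ^ 2) '' assignments n k)

lemma le_maxSq {x : Fin n → ℝ} (hx : x ∈ assignments n k) (w : Fin n → ℝ) :
    (x ⬝ᵥ w) ^ 2 ≤ maxSq k w :=
  le_csSup ((finite_assignments n k).image _).bddAbove (Set.mem_image_of_mem _ hx)

lemma maxSq_le {w : Fin n → ℝ} {B : ℝ} (hB : 0 ≤ B)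
    (h : ∀ x ∈ assignments n k, (x ⬝ᵥ w) ^ 2 ≤ B) : maxSq k w ≤ B :=
  Real.sSup_le (by rintro _ ⟨x, hx, rfl⟩; exact h x hx) hB

lemma maxSq_nonneg (w : Fin n → ℝ) : 0 ≤ maxSq k w :=
  Real.sSup_nonneg (by rintro _ ⟨x, -, rfl⟩; positivity)

lemma maxSq_le_mul_dotProduct (w : Fin n → ℝ) : maxSq k w ≤ k * (w ⬝ᵥ w) := by
  refine maxSq_le (mul_nonneg (Nat.cast_nonneg k) (dotProduct_self_nonneg' w)) fun x hx => ?_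
  rw [← dotProduct_self_of_mem hx]
  exact dotProduct_sq_le x w

lemma maxSq_smul (c : ℝ) (w : Fin n → ℝ) : maxSq k (c • w) = c ^ 2 * maxSq k w := by
  rw [maxSq, maxSq, ← smul_eq_mul, ← Real.sSup_smul_of_nonneg (sq_nonneg c), ← Set.image_smul,
    Set.image_image]
  simp only [dotProduct_smul, smul_eq_mul, mul_pow]

@[fun_prop]
lemma measurable_maxSq : Measurable (maxSq k : (Fin n → ℝ) → ℝ) :=
  Measurable.sSup (f := fun (x w : Fin n → ℝ) => (x ⬝ᵥ w) ^ 2) (finite_assignments n k).countable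
    fun x _ => by fun_prop

lemma precision_le_optValue {p : ℕ} (Z : Matrix (Fin n) (Fin p) ℝ) {x : Fin n → ℝ}
    (hx : x ∈ assignments n k) : precision Z x ≤ optValue Z k :=
  le_csSup ((finite_assignments n k).image _).bddAbove (Set.mem_image_of_mem _ hx)

variable {d : ℕ}

lemma continuous_dataMatrix :
    Continuous (dataMatrix : (Fin n → Fin d → ℝ) → Matrix (Fin n) (Fin (d + 1)) ℝ) := by
  refine continuous_matrix fun i j => ?_
  refine Fin.lastCases ?_ (fun j => ?_) j
  · simpa [dataMatrix] using continuous_const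
  · simp only [dataMatrix, Matrix.of_apply, Fin.snoc_castSucc]
    fun_prop

@[fun_prop]
lemma measurable_perpProj_dataMatrix (i j : Fin n) :
    Measurable fun G : Fin n → Fin d → ℝ => perpProj (dataMatrix G) i j := by
  have hc : Continuous fun G : Fin n → Fin d → ℝ => (dataMatrix G)ᵀ * dataMatrix G :=
    continuous_dataMatrix.matrix_transpose.matrix_mul continuous_dataMatrix
  have h1 : ∀ G : Fin n → Fin d → ℝ, perpProj (dataMatrix G) i j
      = (1 : Matrix (Fin n) (Fin n) ℝ) i j - ((dataMatrix G)ᵀ * dataMatrix G).det⁻¹ *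
        (dataMatrix G * ((dataMatrix G)ᵀ * dataMatrix G).adjugate * (dataMatrix G)ᵀ) i j := by
    intro G
    rw [perpProj, Matrix.inv_def, Ring.inverse_eq_inv']
    simp
  simp_rw [h1]
  have h2 : Continuous fun G : Fin n → Fin d → ℝ =>
      (dataMatrix G * ((dataMatrix G)ᵀ * dataMatrix G).adjugate * (dataMatrix G)ᵀ) i j :=
    ((continuous_dataMatrix.matrix_mul hc.matrix_adjugate).matrix_mul
      continuous_dataMatrix.matrix_transpose).matrix_elem i j
  exact measurable_const.sub (hc.matrix_det.measurable.inv.mul h2.measurable)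

lemma measurable_optValue :
    Measurable fun G : Fin n → Fin d → ℝ => optValue (dataMatrix G) k :=
  Measurable.sSup (f := fun x (G : Fin n → Fin d → ℝ) => precision (dataMatrix G) x)
    (finite_assignments n k).countable fun x _ => by unfold precision; fun_prop

lemma optValue_nonneg {p : ℕ} {Z : Matrix (Fin n) (Fin p) ℝ} (hZ : IsUnit (Zᵀ * Z).det) :
    0 ≤ optValue Z k :=
  Real.sSup_nonneg (by rintro _ ⟨x, -, rfl⟩; exact precision_nonneg hZ x)

lemma optValue_le {p : ℕ} {Z : Matrix (Fin n) (Fin p) ℝ} (hZ : IsUnit (Zᵀ * Z).det) :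
    optValue Z k ≤ k := by
  refine Real.sSup_le ?_ (Nat.cast_nonneg k)
  rintro _ ⟨x, hx, rfl⟩
  exact (precision_le_dotProduct hZ x).trans_eq (dotProduct_self_of_mem hx)

lemma integrable_optValue (h : d + 1 ≤ n) :
    Integrable (fun G => optValue (dataMatrix G) k) (gaussianCovariates n d) := by
  refine Integrable.of_bound (C := k) measurable_optValue.aestronglyMeasurable ?_
  filter_upwards [ae_isUnit_det h] with G hG
  rw [Real.norm_eq_abs, abs_of_nonneg (optValue_nonneg hG)]
  exact optValue_le hG

lemma meanOptValue_le (h : d + 1 ≤ n) : meanOptValue n d k ≤ k := by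
  calc meanOptValue n d k ≤ ∫ _, (k : ℝ) ∂(gaussianCovariates n d) := by
        refine integral_mono_ae (integrable_optValue h) (integrable_const _) ?_
        filter_upwards [ae_isUnit_det h] with G hG using optValue_le hG
    _ = k := by simp

end Assignments

section Direction

variable {n d k : ℕ}

/-- The direction of the residual of `g` after regression on the data matrix: the residual divided
by its length (and zero if the residual vanishes). -/
noncomputable def residualDir (G : Fin n → Fin d → ℝ) (g : Fin n → ℝ) : Fin n → ℝ :=
  (√((perpProj (dataMatrix G) *ᵥ g) ⬝ᵥ (perpProj (dataMatrix G) *ᵥ g)))⁻¹ •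
    (perpProj (dataMatrix G) *ᵥ g)

lemma measurable_residualDir :
    Measurable fun p : (Fin n → Fin d → ℝ) × (Fin n → ℝ) => residualDir p.1 p.2 := by
  have h : Measurable fun p : (Fin n → Fin d → ℝ) × (Fin n → ℝ) =>
      perpProj (dataMatrix p.1) *ᵥ p.2 :=
    measurable_mulVec (fun i j => (measurable_perpProj_dataMatrix i j).comp measurable_fst)
      measurable_snd
  unfold residualDir
  fun_prop

/-- The law of the direction of the residual of an independent standard Gaussian vector. -/
noncomputable def directionLaw (n d : ℕ) : Measure (Fin n → ℝ) :=
  ((gaussianCovariates n d).prod (gaussianVector n)).map fun p => residualDir p.1 p.2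

instance (n d : ℕ) : IsProbabilityMeasure (directionLaw n d) :=
  Measure.isProbabilityMeasure_map measurable_residualDir.aemeasurable

lemma measurePreserving_mul_gaussianCovariates {R : Matrix (Fin n) (Fin n) ℝ} (hR : Rᵀ * R = 1) :
    MeasurePreserving (fun (G : Fin n → Fin d → ℝ) => (fun i j => (R * Matrix.of G) i j))
      (gaussianCovariates n d) (gaussianCovariates n d) := by
  have hT := measurePreserving_transpose_gaussianCovariates n d
  have hS : MeasurePreserving (fun (C : Fin d → Fin n → ℝ) i j => C j i)
      (Measure.pi fun _ : Fin d => gaussianVector n) (gaussianCovariates n d) := by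
    refine ⟨by fun_prop, ?_⟩
    rw [← hT.map_eq, Measure.map_map (by fun_prop) (by fun_prop)]
    exact Measure.map_id
  have hP := measurePreserving_pi (fun _ : Fin d => gaussianVector n)
    (fun _ : Fin d => gaussianVector n) (fun _ => measurePreserving_mulVec_gaussianVector hR)
  exact hS.comp (hP.comp hT)

lemma dataMatrix_mul {R : Matrix (Fin n) (Fin n) ℝ} (hR1 : R *ᵥ 1 = 1)
    (G : Fin n → Fin d → ℝ) :
    dataMatrix (fun i j => (R * Matrix.of G) i j) = R * dataMatrix G := by
  refine Matrix.ext fun i j => ?_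
  refine Fin.lastCases ?_ (fun j => ?_) j
  · have := congrFun hR1 i
    simp only [Matrix.mulVec, dotProduct, Pi.one_apply, mul_one] at this
    simp [dataMatrix, Matrix.mul_apply, this]
  · simp [dataMatrix, Matrix.mul_apply]

lemma map_mulVec_directionLaw {R : Matrix (Fin n) (Fin n) ℝ} (hR : Rᵀ * R = 1)
    (hR1 : R *ᵥ 1 = 1) : (directionLaw n d).map (fun u => R *ᵥ u) = directionLaw n d := by
  have hmp := (measurePreserving_mul_gaussianCovariates (d := d) hR).prod
    (measurePreserving_mulVec_gaussianVector hR)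
  rw [directionLaw, Measure.map_map (by fun_prop) measurable_residualDir]
  conv_rhs => rw [← hmp.map_eq, Measure.map_map measurable_residualDir hmp.measurable]
  congr 1
  ext1 ⟨G, g⟩
  have hw : perpProj (dataMatrix (fun i j => (R * Matrix.of G) i j)) *ᵥ (R *ᵥ g)
      = R *ᵥ (perpProj (dataMatrix G) *ᵥ g) := by
    rw [dataMatrix_mul hR1, perpProj_orthogonal_mul _ hR, Matrix.mulVec_mulVec, Matrix.mul_assoc,
      hR, Matrix.mul_one, Matrix.mulVec_mulVec]
  have hlen : ∀ w : Fin n → ℝ, (R *ᵥ w) ⬝ᵥ (R *ᵥ w) = w ⬝ᵥ w := by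
    intro w
    rw [Matrix.dotProduct_mulVec, ← Matrix.mulVec_transpose, Matrix.mulVec_mulVec, hR,
      Matrix.one_mulVec]
  simp only [Function.comp_apply, Prod.map_apply, residualDir, hw, hlen, Matrix.mulVec_smul]

/-- The residual of an independent Gaussian vector almost surely does not vanish. -/
lemma ae_residual_ne_zero (h : d + 2 ≤ n) :
    ∀ᵐ p ∂((gaussianCovariates n d).prod (gaussianVector n)),
      IsUnit ((dataMatrix p.1)ᵀ * dataMatrix p.1).det ∧ perpProj (dataMatrix p.1) *ᵥ p.2 ≠ 0 := by
  have h1 : ∀ᵐ p ∂((gaussianCovariates n d).prod (gaussianVector n)),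
      IsUnit ((dataMatrix p.1)ᵀ * dataMatrix p.1).det :=
    Measure.quasiMeasurePreserving_fst.ae (ae_isUnit_det (by omega))
  have hm : Measurable fun p : (Fin n → Fin d → ℝ) × (Fin n → ℝ) =>
      perpProj (dataMatrix p.1) *ᵥ p.2 :=
    measurable_mulVec (fun i j => (measurable_perpProj_dataMatrix i j).comp measurable_fst)
      measurable_snd
  have h2 : ∀ᵐ p ∂((gaussianCovariates n d).prod (gaussianVector n)),
      perpProj (dataMatrix p.1) *ᵥ p.2 ≠ 0 := by
    refine (Measure.ae_prod_iff_ae_ae (hm (measurableSet_singleton 0).compl)).2 ?_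
    refine Filter.Eventually.of_forall fun G => ?_
    have hne : LinearMap.range (dataMatrix G).mulVecLin ≠ ⊤ := by
      intro htop
      have := LinearMap.finrank_range_le (dataMatrix G).mulVecLin
      rw [htop, finrank_top] at this
      simp at this
      omega
    filter_upwards [ae_notMem_of_ne_top hne] with g hg h0
    obtain ⟨a, ha⟩ := mem_range_of_perpProj_mulVec_eq_zero h0
    exact hg ⟨a, ha.symm⟩
  filter_upwards [h1, h2] with p hp1 hp2 using ⟨hp1, hp2⟩

lemma one_dotProduct_perpProj {G : Fin n → Fin d → ℝ}
    (hG : IsUnit ((dataMatrix G)ᵀ * dataMatrix G).det) (g : Fin n → ℝ) :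
    1 ⬝ᵥ (perpProj (dataMatrix G) *ᵥ g) = 0 := by
  have h1 : (1 : Fin n → ℝ) = dataMatrix G *ᵥ Pi.single (Fin.last d) 1 := by
    rw [dataMatrix_mulVec]
    simp
  rw [← perpProj_dotProduct, h1, Matrix.mulVec_mulVec, perpProj_mul_self hG, Matrix.zero_mulVec,
    zero_dotProduct]

lemma ae_directionLaw (h : d + 2 ≤ n) :
    (∀ᵐ u ∂(directionLaw n d), 1 ⬝ᵥ u = 0) ∧ ∀ᵐ u ∂(directionLaw n d), u ⬝ᵥ u = 1 := by
  constructor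
  · refine (ae_map_iff measurable_residualDir.aemeasurable
      (measurableSet_eq_fun (by fun_prop) measurable_const)).2 ?_
    filter_upwards [ae_residual_ne_zero h] with p hp
    simp [residualDir, one_dotProduct_perpProj hp.1]
  · refine (ae_map_iff measurable_residualDir.aemeasurable
      (measurableSet_eq_fun (by fun_prop) measurable_const)).2 ?_
    filter_upwards [ae_residual_ne_zero h] with p hp
    set w := perpProj (dataMatrix p.1) *ᵥ p.2
    have hw : 0 < w ⬝ᵥ w := (dotProduct_self_nonneg' w).lt_of_ne
      fun h0 => hp.2 (dotProduct_self_eq_zero.1 h0.symm)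
    have hs := Real.mul_self_sqrt hw.le
    have hs0 : √(w ⬝ᵥ w) ≠ 0 := (Real.sqrt_pos.2 hw).ne'
    rw [show residualDir p.1 p.2 = (√(w ⬝ᵥ w))⁻¹ • w from rfl, smul_dotProduct, dotProduct_smul,
      smul_eq_mul, smul_eq_mul]
    nth_rw 3 [← hs]
    field_simp

lemma dotProduct_residualDir_sq (G : Fin n → Fin d → ℝ) (g x : Fin n → ℝ) :
    (x ⬝ᵥ residualDir G g) ^ 2 = (x ⬝ᵥ (perpProj (dataMatrix G) *ᵥ g)) ^ 2 /
      ((perpProj (dataMatrix G) *ᵥ g) ⬝ᵥ (perpProj (dataMatrix G) *ᵥ g)) := by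
  rw [residualDir, dotProduct_smul, smul_eq_mul, mul_pow, inv_pow,
    Real.sq_sqrt (dotProduct_self_nonneg' _), inv_mul_eq_div]

lemma dotProduct_perpProj_mulVec {G : Fin n → Fin d → ℝ}
    (hG : IsUnit ((dataMatrix G)ᵀ * dataMatrix G).det) (x g : Fin n → ℝ) :
    x ⬝ᵥ (perpProj (dataMatrix G) *ᵥ g)
      = (perpProj (dataMatrix G) *ᵥ x) ⬝ᵥ (perpProj (dataMatrix G) *ᵥ g) := by
  rw [perpProj_dotProduct, Matrix.mulVec_mulVec, perpProj_mul_perpProj hG]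

lemma maxSq_residualDir_le {G : Fin n → Fin d → ℝ}
    (hG : IsUnit ((dataMatrix G)ᵀ * dataMatrix G).det) (g : Fin n → ℝ) :
    maxSq k (residualDir G g) ≤ optValue (dataMatrix G) k := by
  refine maxSq_le (optValue_nonneg hG) fun x hx => ?_
  refine le_trans ?_ (precision_le_optValue _ hx)
  rw [dotProduct_residualDir_sq, precision_eq_dotProduct hG]
  refine div_le_of_le_mul₀ (dotProduct_self_nonneg' _) (dotProduct_self_nonneg' _) ?_
  rw [dotProduct_perpProj_mulVec hG]
  exact dotProduct_sq_le _ _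

/-- With as many as `n - 1` columns the residual projection has rank one, hence is determined by a
nonzero residual. -/
lemma optValue_le_maxSq_residualDir (hd : d + 2 = n) {G : Fin n → Fin d → ℝ}
    (hG : IsUnit ((dataMatrix G)ᵀ * dataMatrix G).det) {g : Fin n → ℝ}
    (hg : perpProj (dataMatrix G) *ᵥ g ≠ 0) :
    optValue (dataMatrix G) k ≤ maxSq k (residualDir G g) := by
  refine Real.sSup_le ?_ (maxSq_nonneg _)
  rintro _ ⟨x, hx, rfl⟩
  refine le_trans ?_ (le_maxSq hx _)
  have hPZ : ∀ a, perpProj (dataMatrix G) *ᵥ (dataMatrix G *ᵥ a) = 0 := fun a => by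
    rw [Matrix.mulVec_mulVec, perpProj_mul_self hG, Matrix.zero_mulVec]
  -- the columns of the data matrix together with `g` form a basis
  have hsurj : Function.Surjective
      (LinearMap.coprod (dataMatrix G).mulVecLin (LinearMap.toSpanSingleton ℝ (Fin n → ℝ) g)) := by
    rw [← LinearMap.injective_iff_surjective_of_finrank_eq_finrank (by simp; omega)]
    rw [← LinearMap.ker_eq_bot, LinearMap.ker_eq_bot']
    rintro ⟨a, c⟩ hac
    simp only [LinearMap.coprod_apply, Matrix.mulVecLin_apply,
      LinearMap.toSpanSingleton_apply] at hac
    have h1 := congrArg (fun v => perpProj (dataMatrix G) *ᵥ v) hac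
    simp only [Matrix.mulVec_add, hPZ, Matrix.mulVec_smul, Matrix.mulVec_zero, zero_add] at h1
    have hc : c = 0 := (smul_eq_zero.1 h1).resolve_right hg
    rw [hc, zero_smul, add_zero] at hac
    have ha : a = 0 := by
      have h3 : ((dataMatrix G)ᵀ * dataMatrix G) *ᵥ a = 0 := by
        rw [← Matrix.mulVec_mulVec, hac, Matrix.mulVec_zero]
      exact Matrix.mulVec_injective_iff_isUnit.2
        ((Matrix.isUnit_iff_isUnit_det _).2 hG) (h3.trans (Matrix.mulVec_zero _).symm)
    rw [ha, hc]; rfl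
  obtain ⟨⟨a, c⟩, hac⟩ := hsurj x
  simp only [LinearMap.coprod_apply, Matrix.mulVecLin_apply,
    LinearMap.toSpanSingleton_apply] at hac
  have hPx : perpProj (dataMatrix G) *ᵥ x = c • (perpProj (dataMatrix G) *ᵥ g) := by
    rw [← hac, Matrix.mulVec_add, hPZ, zero_add, Matrix.mulVec_smul]
  rw [dotProduct_residualDir_sq, precision_eq_dotProduct hG, dotProduct_perpProj_mulVec hG x g, hPx]
  set w := perpProj (dataMatrix G) *ᵥ g
  have hw : w ⬝ᵥ w ≠ 0 := fun h0 => hg (dotProduct_self_eq_zero.1 h0)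
  simp only [smul_dotProduct, dotProduct_smul, smul_eq_mul]
  apply le_of_eq
  field_simp

lemma integral_dotProduct_sq (a : Fin n → ℝ) :
    Integrable (fun h => (a ⬝ᵥ h) ^ 2) (gaussianVector n) ∧
      ∫ h, (a ⬝ᵥ h) ^ 2 ∂(gaussianVector n) = a ⬝ᵥ a := by
  have hmap := map_dotProduct_gaussianVector a
  have hint : Integrable (fun y : ℝ => y ^ 2) (gaussianReal 0 (a ⬝ᵥ a).toNNReal) :=
    (memLp_id_gaussianReal 2).integrable_sq
  constructor
  · rw [← hmap] at hint
    exact hint.comp_measurable (by fun_prop)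
  · have h1 : ∫ y, y ^ 2 ∂(gaussianReal 0 (a ⬝ᵥ a).toNNReal) = a ⬝ᵥ a := by
      have hv := variance_fun_id_gaussianReal (μ := 0) (v := (a ⬝ᵥ a).toNNReal)
      rw [variance_eq_integral (by fun_prop)] at hv
      simpa [Real.coe_toNNReal _ (dotProduct_self_nonneg' a)] using hv
    rw [← h1, ← hmap, integral_map (by fun_prop) (by fun_prop)]

lemma integral_dotProduct_self :
    Integrable (fun h => h ⬝ᵥ h) (gaussianVector n) ∧
      ∫ h, h ⬝ᵥ h ∂(gaussianVector n) = n := by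
  have h1 : ∀ h : Fin n → ℝ, h ⬝ᵥ h = ∑ i, ((Pi.single i 1 : Fin n → ℝ) ⬝ᵥ h) ^ 2 := by
    intro h
    simp [dotProduct, sq, Pi.single_apply]
  simp_rw [h1]
  refine ⟨integrable_finsetSum _ fun i _ => (integral_dotProduct_sq _).1, ?_⟩
  rw [integral_finsetSum _ fun i _ => (integral_dotProduct_sq _).1]
  simp_rw [(integral_dotProduct_sq _).2]
  simp

lemma center_dotProduct_self [NeZero n] (h : Fin n → ℝ) :
    center h ⬝ᵥ center h = h ⬝ᵥ h - (1 ⬝ᵥ h) ^ 2 / n := by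
  rw [center_dotProduct_of_orthogonal h (one_dotProduct_center h), dotProduct_center_eq]
  ring

lemma integral_center_dotProduct_self [NeZero n] :
    ∫ h, center h ⬝ᵥ center h ∂(gaussianVector n) = n - 1 := by
  have hn : (n : ℝ) ≠ 0 := by exact_mod_cast NeZero.ne n
  simp_rw [center_dotProduct_self]
  rw [integral_sub integral_dotProduct_self.1 ((integral_dotProduct_sq 1).1.div_const _),
    integral_div, integral_dotProduct_self.2, (integral_dotProduct_sq 1).2]
  simp [hn]

lemma integral_maxSq_center [NeZero n] (h : d + 2 ≤ n) :
    ∫ h, maxSq k (center h) ∂(gaussianVector n)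
      = (n - 1) * ∫ u, maxSq k u ∂(directionLaw n d) := by
  have hmap := map_norm_smul_eq_map_center (fun R hR hR1 => map_mulVec_directionLaw (d := d) hR hR1)
    (ae_directionLaw h).1 (ae_directionLaw h).2
  rw [← integral_map measurable_center.aemeasurable (measurable_maxSq.aestronglyMeasurable), ← hmap,
    integral_map (Measurable.aemeasurable (by fun_prop)) measurable_maxSq.aestronglyMeasurable]
  simp_rw [maxSq_smul, Real.sq_sqrt (dotProduct_self_nonneg' _), mul_comm _ (maxSq k _)]
  rw [integral_prod_mul (fun u => maxSq k u) (fun h => center h ⬝ᵥ center h),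
    integral_center_dotProduct_self, mul_comm]

lemma integral_maxSq_directionLaw :
    ∫ u, maxSq k u ∂(directionLaw n d) = ∫ p, maxSq k (residualDir p.1 p.2)
      ∂((gaussianCovariates n d).prod (gaussianVector n)) :=
  integral_map measurable_residualDir.aemeasurable measurable_maxSq.aestronglyMeasurable

lemma integrable_optValue_fst (h : d + 2 ≤ n) :
    Integrable (fun p => optValue (dataMatrix p.1) k)
      ((gaussianCovariates n d).prod (gaussianVector n)) :=
  (integrable_optValue (by omega)).comp_fst _

lemma meanOptValue_eq_integral_prod : meanOptValue n d k
    = ∫ p, optValue (dataMatrix p.1) k ∂((gaussianCovariates n d).prod (gaussianVector n)) := by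
  rw [integral_fun_fst (fun G => optValue (dataMatrix G) k)]
  simp [meanOptValue]

/-- Projecting further, onto the single direction of an independent residual, bounds the mean
optimal value below, whatever the number of covariates. -/
lemma integral_maxSq_center_le (h : d + 2 ≤ n) :
    ∫ h, maxSq k (center h) ∂(gaussianVector n) ≤ (n - 1) * meanOptValue n d k := by
  have : NeZero n := ⟨by omega⟩
  rw [integral_maxSq_center h, integral_maxSq_directionLaw, meanOptValue_eq_integral_prod]
  have hn : (1 : ℝ) ≤ n := by exact_mod_cast (by omega : 1 ≤ n)
  refine mul_le_mul_of_nonneg_left ?_ (by linarith)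
  refine integral_mono_of_nonneg (Filter.Eventually.of_forall fun p => maxSq_nonneg _)
    (integrable_optValue_fst h) ?_
  filter_upwards [ae_residual_ne_zero h] with p hp using maxSq_residualDir_le hp.1 p.2

lemma integral_maxSq_center_eq (h : d + 2 = n) :
    ∫ h, maxSq k (center h) ∂(gaussianVector n) = (n - 1) * meanOptValue n d k := by
  have : NeZero n := ⟨by omega⟩
  rw [integral_maxSq_center h.le, integral_maxSq_directionLaw, meanOptValue_eq_integral_prod]
  congr 1
  refine integral_congr_ae ?_
  filter_upwards [ae_residual_ne_zero h.le] with p hp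
  exact le_antisymm (maxSq_residualDir_le hp.1 p.2) (optValue_le_maxSq_residualDir h hp.1 hp.2)

end Direction

/-! ### Upper bound for the centered Gaussian maximum -/

section UpperBound

variable {n k : ℕ}

lemma le_log_add_mul_exp {r : ℝ} (hr : 0 < r) (y : ℝ) :
    y ≤ Real.log r + r⁻¹ * Real.exp y := by
  have h := Real.log_le_sub_one_of_pos (mul_pos (inv_pos.2 hr) (Real.exp_pos y))
  rw [Real.log_mul (inv_ne_zero hr.ne') (Real.exp_pos y).ne', Real.log_inv, Real.log_exp] at h
  linarith

lemma one_lt_div_of_two_mul_lt (hk : 1 ≤ k) (hkn : 2 * k < n) : 2 < (n : ℝ) / k := by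
  have : (0 : ℝ) < k := by exact_mod_cast hk
  rw [lt_div_iff₀ this]
  exact_mod_cast hkn

lemma log_two_le_log_div (hk : 1 ≤ k) (hkn : 2 * k < n) :
    Real.log 2 ≤ Real.log ((n : ℝ) / k) :=
  Real.log_le_log (by norm_num) (one_lt_div_of_two_mul_lt hk hkn).le

/-- The bound `a hᵢ² ≤ log (n / k) + (k / n) exp (a hᵢ²)` costs `log (n / k)` for each of the `k`
treated users, plus a term that does not depend on the assignment. -/
lemma maxSq_center_le (hk : 1 ≤ k) (hkn : 2 * k < n) {a : ℝ} (ha : 0 < a) (h : Fin n → ℝ) :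
    maxSq k (center h) ≤ 2 * (a⁻¹ * (k ^ 2 * Real.log ((n : ℝ) / k) +
      k ^ 2 / n * ∑ i, Real.exp (a * h i ^ 2))) + 2 * (k ^ 2 / n ^ 2 * (1 ⬝ᵥ h) ^ 2) := by
  have hk0 : (0 : ℝ) < k := by exact_mod_cast hk
  have hn0 : (0 : ℝ) < n := by exact_mod_cast (by omega : 0 < n)
  have hlog : 0 ≤ Real.log ((n : ℝ) / k) :=
    (Real.log_nonneg (by norm_num)).trans (log_two_le_log_div hk hkn)
  refine maxSq_le (by positivity) fun x hx => ?_
  have hxi : ∀ i, x i * x i = x i := fun i => by rcases hx.1 i with h | h <;> simp [h]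
  have hx0 : ∀ i, 0 ≤ x i := fun i => by rcases hx.1 i with h | h <;> simp [h]
  have hx1 : ∀ i, x i ≤ 1 := fun i => by rcases hx.1 i with h | h <;> simp [h]
  have h1 : (x ⬝ᵥ h) ^ 2 ≤ k * ∑ i, x i * h i ^ 2 := by
    have h2 := dotProduct_sq_le x (fun i => x i * h i)
    rw [dotProduct_self_of_mem hx] at h2
    have h3 : x ⬝ᵥ (fun i => x i * h i) = x ⬝ᵥ h :=
      Finset.sum_congr rfl fun i _ => by rw [← mul_assoc, hxi]
    have h4 : (fun i => x i * h i) ⬝ᵥ (fun i => x i * h i) = ∑ i, x i * h i ^ 2 :=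
      Finset.sum_congr rfl fun i _ => by
        calc x i * h i * (x i * h i) = (x i * x i) * h i ^ 2 := by ring
          _ = _ := by rw [hxi]
    rwa [h3, h4] at h2
  have h5 : a * ∑ i, x i * h i ^ 2
      ≤ k * Real.log ((n : ℝ) / k) + k / n * ∑ i, Real.exp (a * h i ^ 2) := by
    calc a * ∑ i, x i * h i ^ 2 = ∑ i, x i * (a * h i ^ 2) := by
          rw [Finset.mul_sum]; exact Finset.sum_congr rfl fun i _ => by ring
      _ ≤ ∑ i, (x i * Real.log ((n : ℝ) / k) + k / n * Real.exp (a * h i ^ 2)) := by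
          refine Finset.sum_le_sum fun i _ => ?_
          have h6 := le_log_add_mul_exp (div_pos hn0 hk0) (a * h i ^ 2)
          rw [inv_div] at h6
          have h7 : 0 ≤ (k : ℝ) / n * Real.exp (a * h i ^ 2) := by positivity
          nlinarith [hx0 i, hx1 i, mul_le_mul_of_nonneg_left h6 (hx0 i)]
      _ = _ := by
          rw [Finset.sum_add_distrib, ← Finset.sum_mul, ← Finset.mul_sum, hx.2]
  have h8 : (x ⬝ᵥ h) ^ 2 ≤ a⁻¹ * (k ^ 2 * Real.log ((n : ℝ) / k) +
      k ^ 2 / n * ∑ i, Real.exp (a * h i ^ 2)) := by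
    rw [inv_mul_eq_div, le_div_iff₀ ha]
    calc (x ⬝ᵥ h) ^ 2 * a ≤ k * (∑ i, x i * h i ^ 2) * a := by gcongr
      _ = k * (a * ∑ i, x i * h i ^ 2) := by ring
      _ ≤ k * (k * Real.log ((n : ℝ) / k) + k / n * ∑ i, Real.exp (a * h i ^ 2)) := by gcongr
      _ = _ := by ring
  rw [dotProduct_center_eq, one_dotProduct_of_mem hx]
  calc (x ⬝ᵥ h - k * (1 ⬝ᵥ h) / n) ^ 2
      ≤ 2 * (x ⬝ᵥ h) ^ 2 + 2 * (k * (1 ⬝ᵥ h) / n) ^ 2 := by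
        nlinarith [sq_nonneg (x ⬝ᵥ h + k * (1 ⬝ᵥ h) / n)]
    _ = 2 * (x ⬝ᵥ h) ^ 2 + 2 * (k ^ 2 / n ^ 2 * (1 ⬝ᵥ h) ^ 2) := by
        congr 1; ring
    _ ≤ _ := by gcongr

theorem exists_integral_maxSq_center_le : ∃ C : ℝ, 0 < C ∧ ∀ n k : ℕ, 1 ≤ k → 2 * k < n →
    ∫ h, maxSq k (center h) ∂(gaussianVector n) ≤ C * (k ^ 2 * Real.log ((n : ℝ) / k)) := by
  -- Fernique's theorem supplies some `a > 0` making `exp (a y ^ 2)` integrable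
  obtain ⟨a, ha, hint⟩ := IsGaussian.exists_integrable_exp_sq (gaussianReal 0 1)
  simp only [Real.norm_eq_abs, sq_abs] at hint
  set K := ∫ y, Real.exp (a * y ^ 2) ∂(gaussianReal 0 1) with hK
  have hK0 : 0 ≤ K := integral_nonneg fun y => (Real.exp_pos _).le
  have hl2 : 0 < Real.log 2 := Real.log_pos (by norm_num)
  refine ⟨2 * a⁻¹ + (2 * a⁻¹ * K + 2) / Real.log 2, by positivity, fun n k hk hkn => ?_⟩
  have hn0 : (0 : ℝ) < n := by exact_mod_cast (by omega : 0 < n)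
  have hn1 : (1 : ℝ) ≤ n := by exact_mod_cast (by omega : 1 ≤ n)
  have hcoord : ∀ i : Fin n, Integrable (fun h : Fin n → ℝ => Real.exp (a * h i ^ 2))
      (gaussianVector n) ∧ ∫ h, Real.exp (a * h i ^ 2) ∂(gaussianVector n) = K := by
    intro i
    have hmp := measurePreserving_eval (fun _ : Fin n => gaussianReal 0 1) i
    refine ⟨hmp.integrable_comp_of_integrable hint, ?_⟩
    rw [hK, ← hmp.map_eq, integral_map hmp.measurable.aemeasurable (by fun_prop)]
    rfl
  have hsum : Integrable (fun h : Fin n → ℝ => ∑ i, Real.exp (a * h i ^ 2)) (gaussianVector n) :=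
    integrable_finsetSum _ fun i _ => (hcoord i).1
  have hI1 : Integrable (fun h : Fin n → ℝ => 2 * (a⁻¹ * (k ^ 2 * Real.log ((n : ℝ) / k) +
      k ^ 2 / n * ∑ i, Real.exp (a * h i ^ 2)))) (gaussianVector n) :=
    (((integrable_const _).add (hsum.const_mul _)).const_mul _).const_mul _
  have hI2 : Integrable (fun h : Fin n → ℝ => 2 * (k ^ 2 / n ^ 2 * (1 ⬝ᵥ h) ^ 2))
      (gaussianVector n) := ((integral_dotProduct_sq 1).1.const_mul _).const_mul _
  calc ∫ h, maxSq k (center h) ∂(gaussianVector n)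
      ≤ ∫ h, (2 * (a⁻¹ * (k ^ 2 * Real.log ((n : ℝ) / k) +
      k ^ 2 / n * ∑ i, Real.exp (a * h i ^ 2))) + 2 * (k ^ 2 / n ^ 2 * (1 ⬝ᵥ h) ^ 2))
        ∂(gaussianVector n) :=
        integral_mono_of_nonneg (Filter.Eventually.of_forall fun h => maxSq_nonneg _)
          (hI1.add hI2) (Filter.Eventually.of_forall fun h => maxSq_center_le hk hkn ha h)
    _ = 2 * (a⁻¹ * (k ^ 2 * Real.log ((n : ℝ) / k) + k ^ 2 / n * (n * K)))
        + 2 * (k ^ 2 / n ^ 2 * n) := by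
        rw [integral_add hI1 hI2, integral_const_mul, integral_const_mul,
          integral_add (integrable_const _) (hsum.const_mul _), integral_const, integral_const_mul,
          integral_finsetSum _ fun i _ => (hcoord i).1, integral_const_mul, integral_const_mul,
          (integral_dotProduct_sq 1).2]
        simp [(hcoord _).2]
    _ = k ^ 2 * (2 * a⁻¹ * Real.log ((n : ℝ) / k) + (2 * a⁻¹ * K + 2 / n)) := by
        field_simp
        ring
    _ ≤ k ^ 2 * (2 * a⁻¹ * Real.log ((n : ℝ) / k) +
          (2 * a⁻¹ * K + 2) / Real.log 2 * Real.log ((n : ℝ) / k)) := by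
        have h1 : (2 : ℝ) / n ≤ 2 := div_le_self (by norm_num) hn1
        have h2 : 2 * a⁻¹ * K + 2
            ≤ (2 * a⁻¹ * K + 2) / Real.log 2 * Real.log ((n : ℝ) / k) := by
          rw [div_mul_eq_mul_div, le_div_iff₀ hl2]
          exact mul_le_mul_of_nonneg_left (log_two_le_log_div hk hkn) (by positivity)
        gcongr
        linarith
    _ = _ := by ring

end UpperBound

/-! ### Lower bound for the centered Gaussian maximum -/

section LowerBound

variable {n k : ℕ}

lemma integrable_eval_gaussianVector (i : Fin n) :
    Integrable (fun h : Fin n → ℝ => h i) (gaussianVector n) :=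
  (measurePreserving_eval (fun _ : Fin n => gaussianReal 0 1) i).integrable_comp_of_integrable
    ((memLp_id_gaussianReal 1).integrable (by norm_num))

lemma integral_eval_gaussianVector (i : Fin n) :
    ∫ h : Fin n → ℝ, h i ∂(gaussianVector n) = 0 := by
  have hmp := measurePreserving_eval (fun _ : Fin n => gaussianReal 0 1) i
  have h0 : ∫ y, y ∂(gaussianReal 0 1) = 0 := integral_id_gaussianReal
  rw [← hmp.map_eq, integral_map hmp.measurable.aemeasurable (by fun_prop)] at h0
  exact h0

lemma measurable_sup'_eval (s : Finset (Fin n)) (hs : s.Nonempty) :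
    Measurable fun h : Fin n → ℝ => s.sup' hs h := by
  have := Finset.measurable_sup' hs (f := fun (i : Fin n) (h : Fin n → ℝ) => h i)
    fun i _ => measurable_pi_apply i
  convert this using 1
  ext h
  simp [Finset.sup'_apply]

lemma integrable_sup' (s : Finset (Fin n)) (hs : s.Nonempty) :
    Integrable (fun h : Fin n → ℝ => s.sup' hs h) (gaussianVector n) := by
  have hb : Integrable (fun h : Fin n → ℝ => ∑ i, |h i|) (gaussianVector n) :=
    integrable_finsetSum _ fun i _ => (integrable_eval_gaussianVector i).abs
  refine hb.mono' (measurable_sup'_eval s hs).aestronglyMeasurable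
    (Filter.Eventually.of_forall fun h => ?_)
  obtain ⟨i, -, hi⟩ := s.exists_mem_eq_sup' hs h
  rw [hi, Real.norm_eq_abs]
  exact Finset.single_le_sum (f := fun i => |h i|) (fun _ _ => abs_nonneg _) (Finset.mem_univ i)

/-- The maximum is at least `t` unless all coordinates but one are below `t`, in which case it is
at least the remaining coordinate, which is independent of this event and centered. -/
lemma le_integral_sup' (s : Finset (Fin n)) (hs : s.Nonempty) (t : ℝ) :
    t * (1 - (gaussianReal 0 1).real (Set.Iio t) ^ (s.card - 1))
      ≤ ∫ h, s.sup' hs h ∂(gaussianVector n) := by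
  obtain ⟨i₀, hi₀⟩ := hs
  have hs : s.Nonempty := ⟨i₀, hi₀⟩
  have hprod : ∀ (a : ℝ) (b : Fin n → ℝ),
      ∏ i, (if i = i₀ then a else if i ∈ s then b i else 1) = a * ∏ i ∈ s.erase i₀, b i := by
    intro a b
    rw [← Finset.mul_prod_erase Finset.univ _ (Finset.mem_univ i₀), if_pos rfl]
    congr 1
    rw [← Finset.prod_subset (Finset.erase_subset_erase i₀ (Finset.subset_univ s))]
    · refine Finset.prod_congr rfl fun i hi => ?_
      rw [if_neg (Finset.ne_of_mem_erase hi), if_pos (Finset.mem_of_mem_erase hi)]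
    · intro i hi his
      have hne := Finset.ne_of_mem_erase hi
      rw [if_neg hne, if_neg fun h => his (Finset.mem_erase.2 ⟨hne, h⟩)]
  set b : ℝ → ℝ := (Set.Iio t).indicator 1 with hb
  set f : Fin n → ℝ → ℝ := fun i y => if i = i₀ then y - t else if i ∈ s then b y else 1 with hf
  have hfprod : ∀ h : Fin n → ℝ, ∏ i, f i (h i) = (h i₀ - t) * ∏ i ∈ s.erase i₀, b (h i) := by
    intro h
    rw [← hprod (h i₀ - t) fun i => b (h i)]
    refine Finset.prod_congr rfl fun i _ => ?_
    by_cases hi : i = i₀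
    · simp [hf, hi]
    · simp [hf, hi]
  have hfint : ∀ i, Integrable (f i) (gaussianReal 0 1) := by
    intro i
    have hid : Integrable (fun y : ℝ => y) (gaussianReal 0 1) :=
      (memLp_id_gaussianReal 1).integrable (by norm_num)
    by_cases hi : i = i₀
    · simp only [hf, hi, if_true]
      exact hid.sub (integrable_const t)
    by_cases his : i ∈ s
    · simp only [hf, hi, his, if_true, if_false]
      exact (integrable_const (1 : ℝ)).indicator (measurableSet_Iio (a := t))
    · simp [hf, hi, his]
  have hInt : ∫ h, ∏ i, f i (h i) ∂(gaussianVector n)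
      = -t * (gaussianReal 0 1).real (Set.Iio t) ^ (s.card - 1) := by
    rw [gaussianVector, integral_fintype_prod_eq_prod]
    have h1 : ∀ i, ∫ y, f i y ∂(gaussianReal 0 1)
        = if i = i₀ then -t else if i ∈ s then (gaussianReal 0 1).real (Set.Iio t) else 1 := by
      intro i
      by_cases hi : i = i₀
      · have : ∫ y, (y - t) ∂(gaussianReal 0 1) = -t := by
          have hid : Integrable (fun y : ℝ => y) (gaussianReal 0 1) :=
            (memLp_id_gaussianReal 1).integrable (by norm_num)
          rw [integral_sub hid (integrable_const t)]
          simp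
        simpa [hf, hi] using this
      by_cases his : i ∈ s
      · simp [hf, hi, his, hb]
      · simp [hf, hi, his]
    simp_rw [h1]
    rw [hprod, Finset.prod_const, Finset.card_erase_of_mem hi₀]
  have hprodInt : Integrable (fun h : Fin n → ℝ => ∏ i, f i (h i)) (gaussianVector n) :=
    Integrable.fintype_prod hfint
  calc t * (1 - (gaussianReal 0 1).real (Set.Iio t) ^ (s.card - 1))
      = ∫ h, (t + ∏ i, f i (h i)) ∂(gaussianVector n) := by
        rw [integral_add (integrable_const _) hprodInt, hInt]
        simp
        ring
    _ ≤ _ := by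
        refine integral_mono ((integrable_const _).add hprodInt) (integrable_sup' s hs) fun h => ?_
        simp only [hfprod]
        by_cases hall : ∀ i ∈ s.erase i₀, h i < t
        · have : ∏ i ∈ s.erase i₀, b (h i) = 1 :=
            Finset.prod_eq_one fun i hi => by simp [hb, hall i hi]
          rw [this]
          have := Finset.le_sup' h hi₀
          linarith
        · push Not at hall
          obtain ⟨i, hi, hit⟩ := hall
          have : ∏ i ∈ s.erase i₀, b (h i) = 0 :=
            Finset.prod_eq_zero hi (by simp [hb, hit])
          rw [this]
          have := Finset.le_sup' h (Finset.mem_of_mem_erase hi)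
          linarith

/-- A Gaussian tail bound from integrating the density over `[t, t + 1]` only, using
`(t + 1) ^ 2 / 2 ≤ t ^ 2 + 1`. -/
lemma gaussianReal_Ici_ge {t : ℝ} (ht : 0 ≤ t) :
    (√(2 * Real.pi))⁻¹ * Real.exp (-1) * Real.exp (-t ^ 2)
      ≤ (gaussianReal 0 1).real (Set.Ici t) := by
  have h1 : (gaussianReal 0 1).real (Set.Icc t (t + 1))
      = ∫ y in Set.Icc t (t + 1), gaussianPDFReal 0 1 y := by
    rw [measureReal_def, gaussianReal_apply_eq_integral 0 one_ne_zero, ENNReal.toReal_ofReal]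
    exact integral_nonneg fun y => gaussianPDFReal_nonneg 0 1 y
  calc (√(2 * Real.pi))⁻¹ * Real.exp (-1) * Real.exp (-t ^ 2)
      = ((√(2 * Real.pi))⁻¹ * Real.exp (-1) * Real.exp (-t ^ 2)) *
          volume.real (Set.Icc t (t + 1)) := by simp
    _ ≤ ∫ y in Set.Icc t (t + 1), gaussianPDFReal 0 1 y := by
        refine setIntegral_ge_of_const_le_real measurableSet_Icc (by simp) (fun y hy => ?_)
          (integrable_gaussianPDFReal 0 1).integrableOn
        rw [gaussianPDFReal_def, mul_assoc, ← Real.exp_add]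
        simp only [NNReal.coe_one, mul_one, sub_zero]
        gcongr
        have h2 : y ^ 2 ≤ (t + 1) ^ 2 := by
          have := hy.1
          have := hy.2
          gcongr
          linarith
        nlinarith [sq_nonneg (t - 1)]
    _ = _ := h1.symm
    _ ≤ _ := measureReal_mono Set.Icc_subset_Ici_self

/-- The maximum of `m ≥ 2` independent standard Gaussians has mean at least of order `√(log m)`. -/
theorem exists_le_integral_sup' : ∃ c : ℝ, 0 < c ∧ ∀ (n : ℕ) (s : Finset (Fin n))
    (hs : s.Nonempty), 2 ≤ s.card →
    c * √(Real.log s.card) ≤ ∫ h, s.sup' hs h ∂(gaussianVector n) := by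
  set κ : ℝ := (√(2 * Real.pi))⁻¹ * Real.exp (-1) with hκ
  have hκ0 : 0 < κ := by positivity
  refine ⟨1 - Real.exp (-(κ / 2)), ?_, fun n s hs hcard => ?_⟩
  · have : Real.exp (-(κ / 2)) < 1 := by
      rw [← Real.exp_zero]; exact Real.exp_lt_exp.2 (by linarith)
    linarith
  set m := s.card with hm
  have hm2 : (2 : ℝ) ≤ m := by exact_mod_cast hcard
  have hlog : 0 ≤ Real.log m := Real.log_nonneg (by linarith)
  refine le_trans ?_ (le_integral_sup' s hs √(Real.log m))
  rw [mul_comm]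
  refine mul_le_mul_of_nonneg_left ?_ (Real.sqrt_nonneg _)
  -- at the threshold `√(log m)` the upper tail is at least a constant times `1 / m`, so one of
  -- `m - 1` coordinates exceeds it with probability bounded below
  set t := √(Real.log m)
  have hq := gaussianReal_Ici_ge (Real.sqrt_nonneg (Real.log m))
  rw [Real.sq_sqrt hlog, Real.exp_neg (Real.log m), Real.exp_log (by linarith), ← hκ] at hq
  have hF : (gaussianReal 0 1).real (Set.Iio t) = 1 - (gaussianReal 0 1).real (Set.Ici t) := by
    rw [← Set.compl_Ici, probReal_compl_eq_one_sub measurableSet_Ici]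
  have hFexp : (gaussianReal 0 1).real (Set.Iio t) ≤ Real.exp (-(κ * (m : ℝ)⁻¹)) := by
    rw [hF]
    have := Real.add_one_le_exp (-(κ * (m : ℝ)⁻¹))
    linarith
  have hpow : (gaussianReal 0 1).real (Set.Iio t) ^ (m - 1) ≤ Real.exp (-(κ / 2)) := by
    calc (gaussianReal 0 1).real (Set.Iio t) ^ (m - 1)
        ≤ Real.exp (-(κ * (m : ℝ)⁻¹)) ^ (m - 1) := by gcongr
      _ = Real.exp (((m - 1 : ℕ) : ℝ) * (-(κ * (m : ℝ)⁻¹))) := (Real.exp_nat_mul _ _).symm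
      _ ≤ Real.exp (-(κ / 2)) := by
          refine Real.exp_le_exp.2 ?_
          rw [Nat.cast_sub (by omega), Nat.cast_one]
          have h1 : (1 / 2 : ℝ) ≤ ((m : ℝ) - 1) * (m : ℝ)⁻¹ := by
            rw [← div_eq_mul_inv, le_div_iff₀ (by linarith)]
            linarith
          nlinarith
  linarith

/-- Treating the best user of each of `k` disjoint groups. -/
lemma exists_assignment_dotProduct_eq (B : Fin k → Finset (Fin n)) (hB : ∀ j, (B j).Nonempty)
    (hdisj : Pairwise fun i j => Disjoint (B i) (B j)) (h : Fin n → ℝ) :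
    ∃ x ∈ assignments n k, x ⬝ᵥ h = ∑ j, (B j).sup' (hB j) h := by
  choose i hiB hi using fun j => (B j).exists_mem_eq_sup' (hB j) h
  have hinj : Function.Injective i := by
    intro a b hab
    by_contra hne
    exact Finset.disjoint_left.1 (hdisj hne) (hiB a) (hab ▸ hiB b)
  refine ⟨fun l => if l ∈ Finset.univ.image i then 1 else 0, ⟨fun l => ?_, ?_⟩, ?_⟩
  · by_cases hl : l ∈ Finset.univ.image i
    · right; exact if_pos hl
    · left; exact if_neg hl
  · rw [Finset.sum_ite_mem, Finset.univ_inter, Finset.sum_const,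
      Finset.card_image_of_injective _ hinj]
    simp
  · simp only [dotProduct, ite_mul, one_mul, zero_mul]
    rw [Finset.sum_ite_mem, Finset.univ_inter, Finset.sum_image fun a _ b _ hab => hinj hab]
    exact Finset.sum_congr rfl fun j _ => (hi j).symm

lemma integrable_maxSq_center [NeZero n] :
    Integrable (fun h => maxSq k (center h)) (gaussianVector n) := by
  have hb : Integrable (fun h : Fin n → ℝ => (k : ℝ) * (center h ⬝ᵥ center h))
      (gaussianVector n) := by
    simp_rw [center_dotProduct_self]
    exact (integral_dotProduct_self.1.sub ((integral_dotProduct_sq 1).1.div_const _)).const_mul _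
  refine hb.mono' (measurable_maxSq.comp measurable_center).aestronglyMeasurable
    (Filter.Eventually.of_forall fun h => ?_)
  rw [Real.norm_eq_abs, abs_of_nonneg (maxSq_nonneg _)]
  exact maxSq_le_mul_dotProduct _

/-- The mean of the square is at least the square of the mean; centering does not change the mean of
the total over the best users of the groups. -/
lemma sq_sum_integral_sup'_le [NeZero n] (B : Fin k → Finset (Fin n)) (hB : ∀ j, (B j).Nonempty)
    (hdisj : Pairwise fun i j => Disjoint (B i) (B j)) :
    (∑ j, ∫ h, (B j).sup' (hB j) h ∂(gaussianVector n)) ^ 2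
      ≤ ∫ h, maxSq k (center h) ∂(gaussianVector n) := by
  set A := ∑ j, ∫ h, (B j).sup' (hB j) h ∂(gaussianVector n) with hA
  have hIL : Integrable (fun h => ∑ j, (B j).sup' (hB j) h) (gaussianVector n) :=
    integrable_finsetSum _ fun j _ => integrable_sup' _ _
  have hI1 : Integrable (fun h : Fin n → ℝ => k * (1 ⬝ᵥ h) / n) (gaussianVector n) := by
    simp only [dotProduct, Pi.one_apply, one_mul]
    exact ((integrable_finsetSum _ fun i _ =>
      integrable_eval_gaussianVector i).const_mul _).div_const _
  have h1 : ∫ h : Fin n → ℝ, k * (1 ⬝ᵥ h) / n ∂(gaussianVector n) = 0 := by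
    simp only [dotProduct, Pi.one_apply, one_mul]
    rw [integral_div, integral_const_mul, integral_finsetSum _
      fun i _ => integrable_eval_gaussianVector i]
    simp [integral_eval_gaussianVector]
  calc A ^ 2 = ∫ h, (2 * A * (∑ j, (B j).sup' (hB j) h - k * (1 ⬝ᵥ h) / n) - A ^ 2)
        ∂(gaussianVector n) := by
        have hI2 : Integrable (fun h : Fin n → ℝ =>
            2 * A * (∑ j, (B j).sup' (hB j) h - k * (1 ⬝ᵥ h) / n)) (gaussianVector n) :=
          (hIL.sub hI1).const_mul _
        rw [integral_sub hI2 (integrable_const _), integral_const_mul,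
          integral_sub hIL hI1, h1, integral_finsetSum _ fun j _ => integrable_sup' _ _, ← hA]
        simp
        ring
    _ ≤ _ := by
        refine integral_mono (((hIL.sub hI1).const_mul _).sub (integrable_const _))
          integrable_maxSq_center fun h => ?_
        -- `y ^ 2 ≥ 2 A y - A ^ 2`, which avoids the integrability of the square of the total
        obtain ⟨x, hx, hxh⟩ := exists_assignment_dotProduct_eq B hB hdisj h
        refine le_trans ?_ (le_maxSq hx _)
        rw [dotProduct_center_eq, one_dotProduct_of_mem hx, ← hxh]
        simp only
        nlinarith [sq_nonneg (x ⬝ᵥ h - k * (1 ⬝ᵥ h) / n - A)]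

theorem exists_le_integral_maxSq_center : ∃ c : ℝ, 0 < c ∧ ∀ n k : ℕ, 1 ≤ k → 2 * k < n →
    c * (k ^ 2 * Real.log ((n : ℝ) / k)) ≤ ∫ h, maxSq k (center h) ∂(gaussianVector n) := by
  obtain ⟨c, hc, hsup⟩ := exists_le_integral_sup'
  refine ⟨c ^ 2 / 2, by positivity, fun n k hk hkn => ?_⟩
  have : NeZero n := ⟨by omega⟩
  set m := n / k with hm
  have hm2 : 2 ≤ m := (Nat.le_div_iff_mul_le (by omega)).2 hkn.le
  have hm2' : (2 : ℝ) ≤ m := by exact_mod_cast hm2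
  have hkm : k * m ≤ n := Nat.mul_div_le n k
  obtain ⟨e⟩ : Nonempty (Fin k × Fin m ↪ Fin n) :=
    Function.Embedding.nonempty_of_card_le (by simpa using hkm)
  set B : Fin k → Finset (Fin n) := fun j => Finset.univ.image fun l : Fin m => e (j, l) with hBdef
  have hcard : ∀ j, (B j).card = m := by
    intro j
    rw [hBdef, Finset.card_image_of_injective]
    · simp
    · intro a b hab
      simpa using e.injective hab
  have hB : ∀ j, (B j).Nonempty := fun j => Finset.card_pos.1 (by rw [hcard]; omega)
  have hdisj : Pairwise fun i j => Disjoint (B i) (B j) := by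
    intro i j hij
    rw [Finset.disjoint_left]
    intro l hl hl'
    simp only [hBdef, Finset.mem_image, Finset.mem_univ, true_and] at hl hl'
    obtain ⟨a, ha⟩ := hl
    obtain ⟨b, hb⟩ := hl'
    have := e.injective (ha.trans hb.symm)
    exact hij (congrArg Prod.fst this)
  -- rounding `n / k` down costs only a constant: `n / k < m + 1 ≤ m ^ 2`
  have hlogm : Real.log ((n : ℝ) / k) ≤ 2 * Real.log m := by
    have hk0 : (0 : ℝ) < k := by exact_mod_cast hk
    have hn0 : (0 : ℝ) < n := by exact_mod_cast (by omega : 0 < n)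
    have h1 : (n : ℝ) / k ≤ (m : ℝ) ^ 2 := by
      rw [div_le_iff₀ hk0]
      have h2 : n < (m + 1) * k := by
        have := Nat.lt_div_mul_add (a := n) (b := k) (by omega)
        rw [add_mul, one_mul]
        exact this
      have h3 : (n : ℝ) ≤ (m + 1) * k := by exact_mod_cast h2.le
      nlinarith
    calc Real.log ((n : ℝ) / k) ≤ Real.log ((m : ℝ) ^ 2) := Real.log_le_log (by positivity) h1
      _ = 2 * Real.log m := by rw [Real.log_pow]; norm_num
  have hlog0 : 0 ≤ Real.log m := Real.log_nonneg (by linarith)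
  have hsum : k * (c * √(Real.log m))
      ≤ ∑ j, ∫ h, (B j).sup' (hB j) h ∂(gaussianVector n) := by
    calc k * (c * √(Real.log m)) = ∑ _j : Fin k, c * √(Real.log m) := by simp
      _ ≤ _ := Finset.sum_le_sum fun j _ => by
          have := hsup n (B j) (hB j) (by rw [hcard]; exact hm2)
          rwa [hcard] at this
  calc c ^ 2 / 2 * (k ^ 2 * Real.log ((n : ℝ) / k))
      ≤ c ^ 2 / 2 * (k ^ 2 * (2 * Real.log m)) := by gcongr
    _ = (k * (c * √(Real.log m))) ^ 2 := by
        rw [mul_pow, mul_pow, Real.sq_sqrt hlog0]; ring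
    _ ≤ _ := pow_le_pow_left₀ (by positivity) hsum 2
    _ ≤ _ := sq_sum_integral_sup'_le B hB hdisj

end LowerBound

/-! ### The rates -/

lemma ae_forall_precision_pos {n d k : ℕ} (hk : 1 ≤ k) (hkn : k < n) (h : d + 2 ≤ n) :
    ∀ᵐ G ∂(gaussianCovariates n d), ∀ x ∈ assignments n k, 0 < precision (dataMatrix G) x :=
  (ae_ball_iff (finite_assignments n k).countable).2 fun _ hx =>
    ae_precision_pos h (not_exists_eq_smul_one hk hkn hx)

theorem exists_rate_bounds :
    ∃ c C : ℝ, 0 < c ∧ 0 < C ∧ ∀ n k : ℕ, 1 ≤ k → 2 * k < n →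
      (∀ d : ℕ, d + 1 < n → c * rate n k ≤ meanOptValue n d k) ∧
      (∀ d : ℕ, d + 2 = n → meanOptValue n d k ≤ C * rate n k) := by
  obtain ⟨c, hc, hlow⟩ := exists_le_integral_maxSq_center
  obtain ⟨C, hC, hup⟩ := exists_integral_maxSq_center_le
  refine ⟨c, 2 * C, hc, by positivity, fun n k hk hkn => ⟨fun d hd => ?_, fun d hd => ?_⟩⟩
  · have hn : (3 : ℝ) ≤ n := by exact_mod_cast (by omega : 3 ≤ n)
    have h1 := (hlow n k hk hkn).trans (integral_maxSq_center_le (by omega : d + 2 ≤ n))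
    have hlog : 0 ≤ Real.log ((n : ℝ) / k) :=
      (Real.log_nonneg (by norm_num)).trans (log_two_le_log_div hk hkn)
    have hV : 0 ≤ meanOptValue n d k := by
      have h2 : 0 ≤ ((n : ℝ) - 1) * meanOptValue n d k := le_trans (by positivity) h1
      exact nonneg_of_mul_nonneg_right h2 (by linarith)
    rw [rate, ← mul_div_assoc, div_le_iff₀ (by linarith)]
    nlinarith
  · have hn : (3 : ℝ) ≤ n := by exact_mod_cast (by omega : 3 ≤ n)
    have h1 := hup n k hk hkn
    have hlog : 0 ≤ Real.log ((n : ℝ) / k) :=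
      (Real.log_nonneg (by norm_num)).trans (log_two_le_log_div hk hkn)
    rw [integral_maxSq_center_eq hd] at h1
    have hk2 : 0 ≤ (k : ℝ) ^ 2 * Real.log ((n : ℝ) / k) := by positivity
    rw [rate, ← mul_div_assoc, le_div_iff₀ (by linarith)]
    by_cases hV : 0 ≤ meanOptValue n d k
    · nlinarith
    · push Not at hV
      have h2 : meanOptValue n d k * n ≤ 0 := by nlinarith
      have h3 : 0 ≤ 2 * C * ((k : ℝ) ^ 2 * Real.log ((n : ℝ) / k)) := by positivity
      linarith

lemma mul_le_rate {n k : ℕ} {ρ : ℝ} (hρ : 0 < ρ) (hk : 1 ≤ k) (hkn : 2 * k < n)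
    (hρk : ρ ≤ (k : ℝ) / n) : ρ ^ 2 * Real.log 2 * n ≤ rate n k := by
  have hn : (0 : ℝ) < n := by exact_mod_cast (by omega : 0 < n)
  have hl2 : 0 ≤ Real.log 2 := Real.log_nonneg (by norm_num)
  calc ρ ^ 2 * Real.log 2 * n ≤ ((k : ℝ) / n) ^ 2 * Real.log ((n : ℝ) / k) * n := by
        gcongr
        exact (one_lt_div_of_two_mul_lt hk hkn).le
    _ = rate n k := by
        rw [rate]
        field_simp

end TreatmentAssignment

theorem theorem2 :
    -- the objective is the inverse variance of the least squares estimate of `β`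
    (∀ n k d : ℕ, 1 ≤ k → 2 * k < n → d + 1 < n →
      ∀ᵐ G ∂(TreatmentAssignment.gaussianCovariates n d),
        ∀ x ∈ TreatmentAssignment.assignments n k,
          0 < TreatmentAssignment.precision (TreatmentAssignment.dataMatrix G) x ∧
          ∀ (Ω : Type*) [MeasurableSpace Ω] (μ : Measure Ω) [IsProbabilityMeasure μ]
            (ε : Fin n → Ω → ℝ), TreatmentAssignment.IsWhiteNoise ε μ →
            ∀ (β : ℝ) (γ : Fin (d + 1) → ℝ),
              variance (fun ω => TreatmentAssignment.olsBeta (TreatmentAssignment.dataMatrix G) x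
                (TreatmentAssignment.response (TreatmentAssignment.dataMatrix G) x β γ
                  (fun i => ε i ω))) μ
                = (TreatmentAssignment.precision (TreatmentAssignment.dataMatrix G) x)⁻¹) ∧
    -- the rate guaranteed for every `p = d + 1 < n`, and its sharpness for `p = n - 1`
    (∃ c C : ℝ, 0 < c ∧ 0 < C ∧ ∀ n k : ℕ, 1 ≤ k → 2 * k < n →
      (∀ d : ℕ, d + 1 < n →
        c * TreatmentAssignment.rate n k ≤ TreatmentAssignment.meanOptValue n d k) ∧
      (∀ d : ℕ, d + 2 = n →
        TreatmentAssignment.meanOptValue n d k ≤ C * TreatmentAssignment.rate n k)) ∧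
    -- a constant fraction of treated users: linear growth, for every `p = d + 1 < n`
    (∀ ρ : ℝ, 0 < ρ → ρ < 1 / 2 → ∃ c C : ℝ, 0 < c ∧ 0 < C ∧
      ∀ n k d : ℕ, ρ ≤ (k : ℝ) / n → 2 * k < n → d + 1 < n →
        c * (n : ℝ) ≤ TreatmentAssignment.meanOptValue n d k ∧
        TreatmentAssignment.meanOptValue n d k ≤ C * (n : ℝ) ∧
        c * TreatmentAssignment.rate n k ≤ TreatmentAssignment.meanOptValue n d k ∧
        TreatmentAssignment.meanOptValue n d k ≤ C * TreatmentAssignment.rate n k) := by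
  open TreatmentAssignment in
  refine ⟨fun n k d hk hkn hd => ?_, exists_rate_bounds, fun ρ hρ _ => ?_⟩
  · filter_upwards [ae_isUnit_det (by omega : d + 1 ≤ n),
      ae_forall_precision_pos hk (by omega) (by omega : d + 2 ≤ n)] with G hG hpos x hx
    exact ⟨hpos x hx, fun Ω _ μ _ ε hε β γ => variance_olsBeta hG (hpos x hx) hε β γ⟩
  · obtain ⟨c, C, hc, -, hrate⟩ := exists_rate_bounds
    have hl2 : 0 < Real.log 2 := Real.log_pos (by norm_num)
    set r := ρ ^ 2 * Real.log 2 with hr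
    have hr0 : 0 < r := by positivity
    refine ⟨min c (c * r), max 1 r⁻¹, lt_min hc (mul_pos hc hr0),
      lt_max_of_lt_left one_pos, fun n k d hρk hkn hd => ?_⟩
    have hn : (0 : ℝ) < n := by exact_mod_cast (by omega : 0 < n)
    -- `k = 0` would make `k / n = 0 < ρ`
    have hk : 1 ≤ k := by
      by_contra h0
      have : k = 0 := by omega
      subst this
      simp at hρk
      linarith
    have hlow := (hrate n k hk hkn).1 d hd
    have hlin : r * n ≤ rate n k := mul_le_rate hρ hk hkn hρk
    have hrate0 : 0 ≤ rate n k := le_trans (by positivity) hlin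
    have hup : meanOptValue n d k ≤ n :=
      (meanOptValue_le (by omega)).trans (by exact_mod_cast (by omega : k ≤ n))
    refine ⟨?_, ?_, ?_, ?_⟩
    · calc min c (c * r) * n ≤ c * r * n := by gcongr; exact min_le_right _ _
        _ = c * (r * n) := by ring
        _ ≤ c * rate n k := by gcongr
        _ ≤ _ := hlow
    · calc meanOptValue n d k ≤ 1 * n := by rwa [one_mul]
        _ ≤ max 1 r⁻¹ * n := by gcongr; exact le_max_left _ _
    · exact (mul_le_mul_of_nonneg_right (min_le_left _ _) hrate0).trans hlow
    · calc meanOptValue n d k ≤ n := hup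
        _ = r⁻¹ * (r * n) := by field_simp
        _ ≤ r⁻¹ * rate n k := by gcongr
        _ ≤ max 1 r⁻¹ * rate n k := by gcongr; exact le_max_right _ _
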